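/- Let $B\subset\mathbb{E}^3$ be a compact convex body with non-empty interior whose boundary surface $S=\partial B$ is a $C^2$-smooth embedded surface. Let $h(u)=\max_{x\in B}\langle x,u\rangle$ be its support function on the unit sphere, and suppose that $S$ has constant width $w$, i.e. $h(u)+h(-u)=w$ for all unit vectors $u$. Let $\xi\in\mathbb{C}$ be the coordinate on the unit sphere $S^2$ obtained by stereographic projection from the south pole, $$U(\xi)=\left(\frac{2\,\mathrm{Re}\,\xi}{1+\xi\bar\xi},\frac{2\,\mathrm{Im}\,\xi}{1+\xi\bar\xi},\frac{1-\xi\bar\xi}{1+\xi\bar\xi}\right),$$ and put $r(\xi)=h(U(\xi))$. Identify an oriented line in $\mathbb{E}^3$ with direction $U(\xi)$ with the pair $(\xi,\eta)\in\mathbb{C}^2$ for which its point $(x^1,x^2,x^3)$ closest to the origin is given by $$x^1+ix^2=\frac{2(\eta-\bar\eta\,\xi^2)}{(1+\xi\bar\xi)^2},\qquad x^3=\frac{-2(\eta\bar\xi+\bar\eta\xi)}{(1+\xi\bar\xi)^2}.$$ Then for every $\xi$ there is exactly one outward normal line of $S$ with direction $U(\xi)$; let $(\xi,F(\xi))$ be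 its coordinates. The function $F:\mathbb{C}\to\mathbb{C}$ is of class $C^1$ (in the real sense). Define the slopes of this normal line congruence by $$\psi=(1+\xi\bar\xi)^2\,\frac{\partial}{\partial\xi}\left(\frac{F}{(1+\xi\bar\xi)^2}\right),\qquad \sigma=-\frac{\partial\bar F}{\partial\xi}.$$ Then $\psi$ is real, the integral below converges absolutely, and $$\iint_{S^2}\Big(|\sigma|^2-\big(r-\tfrac12 w+\psi\big)^2\Big)\frac{d\xi\,d\bar\xi}{(1+\xi\bar\xi)^2}\;\ge\;0,$$ where $\frac{d\xi\,d\bar\xi}{(1+\xi\bar\xi)^2}$ denotes the area element $\frac{4\,dx\,dy}{(1+x^2+y^2)^2}$ of the unit sphere, $\xi=x+iy$. Equality holds if and only if $S$ is a round sphere of width $w$ (radius $w/2$, arbitrary centre). -/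

import Mathlib

open MeasureTheory Topology
open scoped InnerProductSpace ComplexConjugate

noncomputable section

/-- Euclidean 3-space. -/
abbrev E3 : Type := EuclideanSpace ℝ (Fin 3)

/-- The point of `E3` with coordinates `z = x¹ + i x²` and `t = x³`. -/
def pointOf (z : ℂ) (t : ℝ) : E3 := !₂[z.re, z.im, t]

/-- Inverse stereographic projection from the south pole: the unit vector with complex
coordinate `ξ = tan (θ / 2) * exp (i φ)`. -/
def sphereDir (ξ : ℂ) : E3 :=
  pointOf (2 * ξ / ((1 + ‖ξ‖ ^ 2 : ℝ) : ℂ)) ((1 - ‖ξ‖ ^ 2) / (1 + ‖ξ‖ ^ 2))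

/-- The vector `V` from the origin to the closest point of the oriented line with complex
coordinates `(ξ, η)`, that is, the tangent vector `η ∂/∂ξ + conj η ∂/∂(conj ξ)` to the unit sphere
at `sphereDir ξ`, regarded as a vector of `E3`. -/
def lineFoot (ξ η : ℂ) : E3 :=
  pointOf (2 * (η - conj η * ξ ^ 2) / (((1 + ‖ξ‖ ^ 2) ^ 2 : ℝ) : ℂ))
    ((-2 * (η * conj ξ + conj η * ξ)).re / (1 + ‖ξ‖ ^ 2) ^ 2)

/-- The point at signed distance `s` from the closest point to the origin, on the oriented line
with coordinates `(ξ, η)`. -/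
def linePoint (ξ η : ℂ) (s : ℝ) : E3 := lineFoot ξ η + s • sphereDir ξ

/-- The boundary surface of `B` is an embedded C² surface: near each of its points it is the zero
set of a C² function with nonvanishing derivative. -/
def HasC2Boundary (B : ConvexBody E3) : Prop :=
  ∀ p ∈ frontier (B : Set E3), ∃ ρ : E3 → ℝ, ContDiffAt ℝ 2 ρ p ∧ fderiv ℝ ρ p ≠ 0 ∧
    ∀ᶠ x in 𝓝 p, (x ∈ frontier (B : Set E3) ↔ ρ x = 0)

/-- The support function: the signed distance from the origin to the tangent plane of `B`
with outward unit normal `u`. -/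
def supportFn (B : ConvexBody E3) (u : E3) : ℝ := sSup ((fun x => ⟪x, u⟫_ℝ) '' (B : Set E3))

/-- `B` has constant width `w`: parallel tangent planes are at distance `w`. -/
def HasConstantWidth (B : ConvexBody E3) (w : ℝ) : Prop :=
  ∀ u : E3, ‖u‖ = 1 → supportFn B u + supportFn B (-u) = w

/-- The support function in the stereographic coordinate. -/
def supportCoord (B : ConvexBody E3) (ξ : ℂ) : ℝ := supportFn B (sphereDir ξ)

/-- `ξ ↦ (ξ, F ξ)` is the congruence of outward normal lines to the boundary of `B`: for every `ξ`,
the oriented line with coordinates `(ξ, F ξ)` meets `B` at a point where the plane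
orthogonal to the line supports `B`, its direction `sphereDir ξ` pointing outwards. -/
def IsNormalCongruence (B : ConvexBody E3) (F : ℂ → ℂ) : Prop :=
  ∀ ξ : ℂ, ∃ s : ℝ, linePoint ξ (F ξ) s ∈ B ∧
    ∀ x ∈ B, ⟪x, sphereDir ξ⟫_ℝ ≤ ⟪linePoint ξ (F ξ) s, sphereDir ξ⟫_ℝ

/-- The Wirtinger derivative `∂f/∂ξ = (∂f/∂x - i ∂f/∂y) / 2`, where `ξ = x + i y`. -/
def dXi (f : ℂ → ℂ) (ξ : ℂ) : ℂ := (fderiv ℝ f ξ 1 - Complex.I * fderiv ℝ f ξ Complex.I) / 2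

/-- The slope `ψ` of the line congruence `ξ ↦ (ξ, F ξ)`. -/
def slopePsi (F : ℂ → ℂ) (ξ : ℂ) : ℂ :=
  (((1 + ‖ξ‖ ^ 2) ^ 2 : ℝ) : ℂ) * dXi (fun ζ => F ζ / (((1 + ‖ζ‖ ^ 2) ^ 2 : ℝ) : ℂ)) ξ

/-- The slope `σ` of the line congruence `ξ ↦ (ξ, F ξ)`. -/
def slopeSigma (F : ℂ → ℂ) (ξ : ℂ) : ℂ := -dXi (fun ζ => conj (F ζ)) ξ

/-- The function `|σ|² - (r - w/2 + ψ)²` times the density `4 / (1 + |ξ|²)²` of the area element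
of the unit sphere with respect to Lebesgue measure `dx dy` in the stereographic coordinate
(`ψ` is real for a normal congruence). -/
def widthIntegrand (B : ConvexBody E3) (w : ℝ) (F : ℂ → ℂ) (ξ : ℂ) : ℝ :=
  (‖slopeSigma F ξ‖ ^ 2 - (supportCoord B ξ - w / 2 + (slopePsi F ξ).re) ^ 2) *
    (4 / (1 + ‖ξ‖ ^ 2) ^ 2)

end

/-! Let `x(u)` be the point of `B` with outward normal `u`. Constant width makes it unique and
Lipschitz in `u`, and with the `C²` boundary this makes it `C¹` (`contDiffAt_supportPoint`). Since
`x(u) - x(-u) = w u` for unit `u`, the map `X(u) = x(u) - (w/2) u` is even: it is a projective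
hedgehog, with odd support function `h - w/2`.

The derivative of `X` on the tangent plane is a symmetric matrix. Its half trace is `r - w/2 + ψ`,
and the norm of its trace-free part is `|σ|`. Hence the integrand is minus its determinant `R₁R₂`
times the area density (`norm_slopeSigma_sq_sub`), and the claim becomes `∫ R₁R₂ ≤ 0` over the
sphere.

This follows from projections, as in Cauchy's area formula. For a unit vector `v`, the integral of
`R₁R₂ max(⟨u,v⟩, 0)` is the signed area swept by the projection along `v` of the hemisphere `⟨u,v⟩ >
0`. By Green's formula it is the area enclosed by the image of the equator, a planar projective
hedgehog, and that area is `-(1/2) ∫ (ρ'² - ρ²)` with `ρ` its antiperiodic support function.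
Wirtinger's inequality makes it nonpositive (`integral_radiiProd_mul_height`). Averaging over `v`
turns `max(⟨u,v⟩, 0)` into a positive constant (`setIntegral_radiiProd_le`).

If the integral vanishes, every projected area vanishes by continuity, and equality in Wirtinger
makes each planar hedgehog a point. Then `⟨X u - X u', u⟩ = 0` for all unit `u, u'`, so `X` is
constant and `S` is a sphere about that point. -/

/-! ### Stereographic coordinates and coordinates of oriented lines -/

theorem pointOf_apply_zero (z : ℂ) (t : ℝ) : pointOf z t 0 = z.re := rfl

theorem pointOf_apply_one (z : ℂ) (t : ℝ) : pointOf z t 1 = z.im := rfl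

theorem pointOf_apply_two (z : ℂ) (t : ℝ) : pointOf z t 2 = t := rfl

theorem Complex.norm_sq_eq_re_im (ξ : ℂ) : ‖ξ‖ ^ 2 = ξ.re ^ 2 + ξ.im ^ 2 := by
  rw [Complex.sq_norm, Complex.normSq_apply]; ring

theorem sphereDir_apply_zero (ξ : ℂ) : sphereDir ξ 0 = 2 * ξ.re / (1 + (ξ.re ^ 2 + ξ.im ^ 2)) := by
  rw [sphereDir, pointOf_apply_zero, Complex.div_ofReal_re, Complex.norm_sq_eq_re_im]; simp

theorem sphereDir_apply_one (ξ : ℂ) : sphereDir ξ 1 = 2 * ξ.im / (1 + (ξ.re ^ 2 + ξ.im ^ 2)) := by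
  rw [sphereDir, pointOf_apply_one, Complex.div_ofReal_im, Complex.norm_sq_eq_re_im]; simp

theorem sphereDir_apply_two (ξ : ℂ) :
    sphereDir ξ 2 = (1 - (ξ.re ^ 2 + ξ.im ^ 2)) / (1 + (ξ.re ^ 2 + ξ.im ^ 2)) := by
  rw [sphereDir, pointOf_apply_two, Complex.norm_sq_eq_re_im]

theorem lineFoot_apply_zero (ξ η : ℂ) :
    lineFoot ξ η 0 = 2 * (η.re - (η.re * (ξ.re ^ 2 - ξ.im ^ 2) + 2 * η.im * ξ.re * ξ.im)) /
      (1 + (ξ.re ^ 2 + ξ.im ^ 2)) ^ 2 := by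
  rw [lineFoot, pointOf_apply_zero, Complex.div_ofReal_re, Complex.norm_sq_eq_re_im]
  simp [pow_two]; ring

theorem lineFoot_apply_one (ξ η : ℂ) :
    lineFoot ξ η 1 = 2 * (η.im - (2 * η.re * ξ.re * ξ.im - η.im * (ξ.re ^ 2 - ξ.im ^ 2))) /
      (1 + (ξ.re ^ 2 + ξ.im ^ 2)) ^ 2 := by
  rw [lineFoot, pointOf_apply_one, Complex.div_ofReal_im, Complex.norm_sq_eq_re_im]
  simp [pow_two]; ring

theorem lineFoot_apply_two (ξ η : ℂ) :
    lineFoot ξ η 2 = -4 * (η.re * ξ.re + η.im * ξ.im) / (1 + (ξ.re ^ 2 + ξ.im ^ 2)) ^ 2 := by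
  rw [lineFoot, pointOf_apply_two, Complex.norm_sq_eq_re_im]
  simp; ring

theorem one_add_sq_add_sq_pos (x y : ℝ) : 0 < 1 + (x ^ 2 + y ^ 2) := by positivity

theorem E3.inner_eq (p q : E3) : ⟪p, q⟫_ℝ = p 0 * q 0 + p 1 * q 1 + p 2 * q 2 := by
  simp [PiLp.inner_apply, Fin.sum_univ_three]; ring

theorem norm_sphereDir (ξ : ℂ) : ‖sphereDir ξ‖ = 1 := by
  have h : ‖sphereDir ξ‖ ^ 2 = 1 := by
    rw [← real_inner_self_eq_norm_sq, E3.inner_eq, sphereDir_apply_zero, sphereDir_apply_one,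
      sphereDir_apply_two]
    have := one_add_sq_add_sq_pos ξ.re ξ.im
    field_simp; ring
  rw [← abs_of_nonneg (norm_nonneg (sphereDir ξ)), ← abs_one, ← sq_eq_sq_iff_abs_eq_abs, h]; simp

theorem sphereDir_ne_zero (ξ : ℂ) : sphereDir ξ ≠ 0 := by
  intro h; have := norm_sphereDir ξ; simp [h] at this

theorem contDiff_sphereDir {n : WithTop ℕ∞} : ContDiff ℝ n sphereDir := by
  have hre : ContDiff ℝ n Complex.re := Complex.reCLM.contDiff
  have him : ContDiff ℝ n Complex.im := Complex.imCLM.contDiff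
  have hs : ContDiff ℝ n (fun ξ : ℂ => 1 + (ξ.re ^ 2 + ξ.im ^ 2)) := by fun_prop
  have hs0 : ∀ ξ : ℂ, 1 + (ξ.re ^ 2 + ξ.im ^ 2) ≠ 0 := fun ξ => (one_add_sq_add_sq_pos _ _).ne'
  rw [contDiff_euclidean]
  intro i
  fin_cases i
  · exact (funext sphereDir_apply_zero ▸ ((contDiff_const.mul hre).div hs hs0) :
      ContDiff ℝ n fun ξ => sphereDir ξ 0)
  · exact (funext sphereDir_apply_one ▸ ((contDiff_const.mul him).div hs hs0) :
      ContDiff ℝ n fun ξ => sphereDir ξ 1)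
  · exact (funext sphereDir_apply_two ▸ ((contDiff_const.sub ((hre.pow 2).add (him.pow 2))).div hs hs0) :
      ContDiff ℝ n fun ξ => sphereDir ξ 2)

theorem E3.ext_three {p q : E3} (h0 : p 0 = q 0) (h1 : p 1 = q 1) (h2 : p 2 = q 2) : p = q := by
  ext i; fin_cases i <;> assumption

/-- This identifies the line coordinate `η` with a tangent vector of the sphere, so that derivatives
of a hedgehog and feet of lines live in the same chart. -/
theorem fderiv_sphereDir (ξ η : ℂ) : fderiv ℝ sphereDir ξ η = lineFoot ξ η := by
  have hd : HasFDerivAt sphereDir (fderiv ℝ sphereDir ξ) ξ :=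
    (contDiff_sphereDir (n := 1)).differentiable one_ne_zero ξ |>.hasFDerivAt
  have hre : HasDerivAt (fun t : ℝ => (ξ + t • η).re) η.re 0 := by
    simpa using ((hasDerivAt_id (0 : ℝ)).mul_const η.re).const_add ξ.re
  have him : HasDerivAt (fun t : ℝ => (ξ + t • η).im) η.im 0 := by
    simpa using ((hasDerivAt_id (0 : ℝ)).mul_const η.im).const_add ξ.im
  have hline : HasDerivAt (fun t : ℝ => ξ + t • η) η 0 := by
    simpa using ((hasDerivAt_id (0 : ℝ)).smul_const η).const_add ξ
  have hd' : HasFDerivAt sphereDir (fderiv ℝ sphereDir ξ) (ξ + (0 : ℝ) • η) := by simpa using hd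
  have hc := hd'.comp_hasDerivAt (0 : ℝ) hline
  have hi : ∀ i, HasDerivAt (fun t : ℝ => sphereDir (ξ + t • η) i) (fderiv ℝ sphereDir ξ η i) 0 :=
    fun i => ((EuclideanSpace.proj i : E3 →L[ℝ] ℝ).hasFDerivAt.comp_hasDerivAt (0 : ℝ) hc)
  have hs := ((hre.pow 2).add (him.pow 2)).const_add 1
  have hp := one_add_sq_add_sq_pos ξ.re ξ.im
  have hs0 : 1 + ((ξ + (0 : ℝ) • η).re ^ 2 + (ξ + (0 : ℝ) • η).im ^ 2) ≠ 0 := by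
    simpa using hp.ne'
  apply E3.ext_three
  · have := (hi 0)
    simp only [sphereDir_apply_zero] at this
    rw [this.unique ((hre.const_mul 2).div hs hs0), lineFoot_apply_zero]
    simp
    field_simp
    ring
  · have := (hi 1)
    simp only [sphereDir_apply_one] at this
    rw [this.unique ((him.const_mul 2).div hs hs0), lineFoot_apply_one]
    simp
    field_simp
    ring
  · have := (hi 2)
    simp only [sphereDir_apply_two] at this
    rw [this.unique ((((hre.pow 2).add (him.pow 2)).const_sub 1).div hs hs0), lineFoot_apply_two]
    simp
    field_simp
    ring

/-- The complex coordinate of the oriented line with direction `sphereDir ξ` through `p`. -/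
noncomputable def lineCoord (ξ : ℂ) : E3 →L[ℝ] ℂ :=
  let x : E3 →L[ℝ] ℝ := EuclideanSpace.proj 0
  let y : E3 →L[ℝ] ℝ := EuclideanSpace.proj 1
  let t : E3 →L[ℝ] ℝ := EuclideanSpace.proj 2
  x.smulRight ((1 - ξ ^ 2) / 2) + y.smulRight (Complex.I * (1 + ξ ^ 2) / 2) + t.smulRight (-ξ)

theorem lineCoord_apply (ξ : ℂ) (p : E3) :
    lineCoord ξ p = p 0 * ((1 - ξ ^ 2) / 2) + p 1 * (Complex.I * (1 + ξ ^ 2) / 2) + p 2 * (-ξ) := by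
  simp [lineCoord]

theorem lineCoord_re (ξ : ℂ) (p : E3) : (lineCoord ξ p).re =
    p 0 * (1 - (ξ.re ^ 2 - ξ.im ^ 2)) / 2 - p 1 * (ξ.re * ξ.im) - p 2 * ξ.re := by
  rw [lineCoord_apply]; simp [pow_two]; ring

theorem lineCoord_im (ξ : ℂ) (p : E3) : (lineCoord ξ p).im =
    - p 0 * (ξ.re * ξ.im) + p 1 * (1 + (ξ.re ^ 2 - ξ.im ^ 2)) / 2 - p 2 * ξ.im := by
  rw [lineCoord_apply]; simp [pow_two]; ring

theorem lineCoord_lineFoot (ξ η : ℂ) : lineCoord ξ (lineFoot ξ η) = η := by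
  have hp := one_add_sq_add_sq_pos ξ.re ξ.im
  apply Complex.ext
  · rw [lineCoord_re, lineFoot_apply_zero, lineFoot_apply_one, lineFoot_apply_two]
    field_simp; ring
  · rw [lineCoord_im, lineFoot_apply_zero, lineFoot_apply_one, lineFoot_apply_two]
    field_simp; ring

theorem lineCoord_sphereDir (ξ : ℂ) : lineCoord ξ (sphereDir ξ) = 0 := by
  have hp := one_add_sq_add_sq_pos ξ.re ξ.im
  apply Complex.ext
  · rw [lineCoord_re, sphereDir_apply_zero, sphereDir_apply_one, sphereDir_apply_two]
    rw [Complex.zero_re]; field_simp; ring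
  · rw [lineCoord_im, sphereDir_apply_zero, sphereDir_apply_one, sphereDir_apply_two]
    rw [Complex.zero_im]; field_simp; ring

theorem inner_lineFoot_sphereDir (ξ η : ℂ) : ⟪lineFoot ξ η, sphereDir ξ⟫_ℝ = 0 := by
  rw [E3.inner_eq, lineFoot_apply_zero, lineFoot_apply_one, lineFoot_apply_two,
    sphereDir_apply_zero, sphereDir_apply_one, sphereDir_apply_two]
  have hp := one_add_sq_add_sq_pos ξ.re ξ.im
  field_simp; ring

/-- The foot of the line through `p` is `p` minus its normal component, so `lineCoord` reads off the
tangential part of any vector. -/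
theorem lineFoot_lineCoord (ξ : ℂ) (p : E3) :
    lineFoot ξ (lineCoord ξ p) + ⟪p, sphereDir ξ⟫_ℝ • sphereDir ξ = p := by
  have hp := one_add_sq_add_sq_pos ξ.re ξ.im
  apply E3.ext_three
  · rw [PiLp.add_apply, PiLp.smul_apply, E3.inner_eq, lineFoot_apply_zero, lineCoord_re, lineCoord_im,
      sphereDir_apply_zero, sphereDir_apply_one, sphereDir_apply_two, smul_eq_mul]
    field_simp; ring
  · rw [PiLp.add_apply, PiLp.smul_apply, E3.inner_eq, lineFoot_apply_one, lineCoord_re, lineCoord_im,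
      sphereDir_apply_zero, sphereDir_apply_one, sphereDir_apply_two, smul_eq_mul]
    field_simp; ring
  · rw [PiLp.add_apply, PiLp.smul_apply, E3.inner_eq, lineFoot_apply_two, lineCoord_re, lineCoord_im,
      sphereDir_apply_zero, sphereDir_apply_one, sphereDir_apply_two, smul_eq_mul]
    field_simp; ring

theorem lineFoot_lineCoord_of_inner_eq_zero {ξ : ℂ} {p : E3} (h : ⟪p, sphereDir ξ⟫_ℝ = 0) :
    lineFoot ξ (lineCoord ξ p) = p := by
  simpa [h] using lineFoot_lineCoord ξ p

/-- The third component of the cross product of two tangent vectors of the unit sphere. -/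
theorem lineFoot_minor (ξ α β : ℂ) :
    lineFoot ξ α 0 * lineFoot ξ β 1 - lineFoot ξ α 1 * lineFoot ξ β 0 =
      (α.re * β.im - α.im * β.re) * (4 / (1 + ‖ξ‖ ^ 2) ^ 2) * sphereDir ξ 2 := by
  rw [lineFoot_apply_zero, lineFoot_apply_one, lineFoot_apply_zero, lineFoot_apply_one,
    sphereDir_apply_two, Complex.norm_sq_eq_re_im]
  have hp := one_add_sq_add_sq_pos ξ.re ξ.im
  field_simp; ring

theorem inner_lineFoot_lineFoot (ξ α β : ℂ) :
    ⟪lineFoot ξ α, lineFoot ξ β⟫_ℝ =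
      (α.re * β.re + α.im * β.im) * (4 / (1 + ‖ξ‖ ^ 2) ^ 2) := by
  rw [E3.inner_eq, lineFoot_apply_zero, lineFoot_apply_one, lineFoot_apply_zero, lineFoot_apply_one,
    lineFoot_apply_two, lineFoot_apply_two, Complex.norm_sq_eq_re_im]
  have hp := one_add_sq_add_sq_pos ξ.re ξ.im
  field_simp; ring

/-! ### Differentiability of a Lipschitz inverse of the Gauss map -/

section InverseGaussMap

variable {E F : Type*} [NormedAddCommGroup E] [NormedSpace ℝ E] [NormedAddCommGroup F]
  [NormedSpace ℝ F]

/-- Because `x` is Lipschitz at `u`, `G'` applied to the difference quotients of `x` along `e` tends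
to `n' e`. The range of `G'` is closed in finite dimension, so the limit stays in it;
differentiability of `x` is not needed. -/
theorem range_fderiv_le_of_comp_eq [FiniteDimensional ℝ F] {G : F → F} {x n : E → F} {u : E}
    {G' : F →L[ℝ] F} {n' : E →L[ℝ] F} (hG : HasFDerivAt G G' (x u)) (hn : HasFDerivAt n n' u)
    (hcomp : ∀ᶠ v in 𝓝 u, G (x v) = n v)
    (hx : (fun v => x v - x u) =O[𝓝 u] fun v => v - u) (e : E) :
    n' e ∈ LinearMap.range (G' : F →ₗ[ℝ] F) := by
  have hxc : Filter.Tendsto x (𝓝 u) (𝓝 (x u)) := 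
    tendsto_sub_nhds_zero_iff.1 (hx.trans_tendsto (tendsto_sub_nhds_zero_iff.2 Filter.tendsto_id))
  have h1 : (fun v => G (x v) - G (x u) - G' (x v - x u)) =o[𝓝 u] fun v => v - u :=
    (hG.isLittleO.comp_tendsto hxc).trans_isBigO hx
  have h2 : (fun v => n v - n u - G' (x v - x u)) =o[𝓝 u] fun v => v - u := by
    refine h1.congr' ?_ Filter.EventuallyEq.rfl
    filter_upwards [hcomp] with v hv
    rw [hv, hcomp.self_of_nhds]
  have h3 : (fun v => n' (v - u) - G' (x v - x u)) =o[𝓝 u] fun v => v - u := by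
    refine (h2.sub hn.isLittleO).congr_left fun v => ?_
    abel
  have hline : Filter.Tendsto (fun t : ℝ => u + t • e) (𝓝[≠] 0) (𝓝 u) := by
    have : Filter.Tendsto (fun t : ℝ => u + t • e) (𝓝 0) (𝓝 (u + (0 : ℝ) • e)) :=
      (continuous_const.add (continuous_id.smul continuous_const)).tendsto 0
    rw [zero_smul, add_zero] at this
    exact this.mono_left nhdsWithin_le_nhds
  have h4 := h3.comp_tendsto hline
  have h5 : (fun t : ℝ => n' (t • e) - G' (x (u + t • e) - x u)) =o[𝓝[≠] 0] fun t : ℝ => t := by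
    have : (fun t : ℝ => n' (t • e) - G' (x (u + t • e) - x u)) =o[𝓝[≠] 0] fun t : ℝ => t • e := by
      simpa [Function.comp_def] using h4
    refine this.trans_isBigO (Asymptotics.IsBigO.of_bound ‖e‖ ?_)
    exact Filter.Eventually.of_forall fun t => by rw [norm_smul, mul_comm]
  have h6 : Filter.Tendsto (fun t : ℝ => t⁻¹ • (n' (t • e) - G' (x (u + t • e) - x u)))
      (𝓝[≠] 0) (𝓝 0) := by
    refine (h5.tendsto_inv_smul_nhds_zero)
  have h7 : Filter.Tendsto (fun t : ℝ => G' (t⁻¹ • (x (u + t • e) - x u))) (𝓝[≠] 0) (𝓝 (n' e)) := by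
    have := (tendsto_const_nhds (x := n' e)).sub h6
    rw [sub_zero] at this
    refine this.congr' ?_
    filter_upwards [self_mem_nhdsWithin] with t ht
    rw [map_smul, map_smul, smul_sub, smul_smul, inv_mul_cancel₀ ht, one_smul]
    abel
  refine (Submodule.closed_of_finiteDimensional (LinearMap.range (G' : F →ₗ[ℝ] F))).mem_of_tendsto
    h7 (Filter.Eventually.of_forall fun t => ⟨_, rfl⟩)

end InverseGaussMap

section Normalize

variable {E : Type*} [NormedAddCommGroup E] [InnerProductSpace ℝ E]

theorem contDiffAt_normalize {n : WithTop ℕ∞} {u : E} (hu : u ≠ 0) :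
    ContDiffAt ℝ n (fun v : E => ‖v‖⁻¹ • v) u :=
  ((contDiffAt_norm ℝ hu).inv (norm_ne_zero_iff.2 hu)).smul contDiffAt_id

theorem HasFDerivAt.norm_mul_apply {c : E →L[ℝ] ℝ} {u : E} (h : HasFDerivAt norm c u) (e : E) :
    ‖u‖ * c e = ⟪u, e⟫_ℝ := by
  have h1 := h.pow 2
  have h2 := (hasStrictFDerivAt_norm_sq u).hasFDerivAt
  have := DFunLike.congr_fun (h1.unique h2) e
  simp at this
  linarith

/-- If the unit normal field of a level set of `ρ` inverts a Lipschitz map `x` of the directions,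
then `x` is of class `C¹`. -/
theorem contDiffAt_of_unitNormal_comp [FiniteDimensional ℝ E] {ρ : E → ℝ} {N x : E → E} {u : E}
    (hu : ‖u‖ = 1) (hρ : ContDiffAt ℝ 1 ρ (x u)) (hρ0 : fderiv ℝ ρ (x u) ≠ 0)
    (hN : ContDiffAt ℝ 1 N (x u)) (hN1 : ∀ᶠ y in 𝓝 (x u), ‖N y‖ = 1)
    (hcomp : ∀ᶠ v in 𝓝 u, N (x v) = ‖v‖⁻¹ • v) (hρx : ∀ᶠ v in 𝓝 u, ρ (x v) = 0)
    (hx : (fun v => x v - x u) =O[𝓝 u] fun v => v - u) : ContDiffAt ℝ 1 x u := by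
  have hu0 : u ≠ 0 := by rintro rfl; simp at hu
  -- `N'` takes values orthogonal to `u`, so `N` cannot be inverted locally. Adding `ρ y • u`
  -- supplies the missing direction and changes nothing along `x`, where `ρ` vanishes.
  let G : E → E := fun y => N y + ρ y • u
  let n : E → E := fun v => ‖v‖⁻¹ • v
  have hGc : ContDiffAt ℝ 1 G (x u) := hN.add (hρ.smul contDiffAt_const)
  have hNu : N (x u) = u := by rw [hcomp.self_of_nhds, hu]; simp
  have hcompG : ∀ᶠ v in 𝓝 u, G (x v) = n v := by
    filter_upwards [hcomp, hρx] with v h1 h2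
    simp [G, n, h1, h2]
  have hNd := (hN.differentiableAt one_ne_zero).hasFDerivAt
  have hρd := (hρ.differentiableAt one_ne_zero).hasFDerivAt
  set N' := fderiv ℝ N (x u)
  set ρ' := fderiv ℝ ρ (x u)
  let G' : E →L[ℝ] E := N' + ρ'.smulRight u
  have hG : HasFDerivAt G G' (x u) := hNd.add (hρd.smul_const u)
  have hN'u : ∀ a, ⟪N' a, u⟫_ℝ = 0 := by
    intro a
    have h1 : HasFDerivAt (fun y => ‖N y‖ ^ 2) (0 : E →L[ℝ] ℝ) (x u) := by
      refine (hasFDerivAt_const (1 : ℝ) (x u)).congr_of_eventuallyEq ?_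
      filter_upwards [hN1] with y hy
      simp [hy]
    have := DFunLike.congr_fun (hNd.norm_sq.unique h1) a
    simp [hNu] at this
    rw [real_inner_comm]; exact this
  have hnormd : HasFDerivAt norm (fderiv ℝ (norm : E → ℝ) u) u :=
    ((contDiffAt_norm (n := 1) ℝ hu0).differentiableAt one_ne_zero).hasFDerivAt
  have hnd : HasFDerivAt n (fderiv ℝ n u) u :=
    ((contDiffAt_normalize (n := 1) hu0).differentiableAt one_ne_zero).hasFDerivAt
  set c := fderiv ℝ (norm : E → ℝ) u
  have hc : ∀ e, c e = ⟪u, e⟫_ℝ := fun e => by simpa [hu] using hnormd.norm_mul_apply e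
  have hn' : ∀ e, fderiv ℝ n u e = e - ⟪u, e⟫_ℝ • u := by
    intro e
    have h1 : HasFDerivAt (fun v : E => ‖v‖ • n v) (ContinuousLinearMap.id ℝ E) u := by
      refine (hasFDerivAt_id u).congr_of_eventuallyEq ?_
      filter_upwards [isOpen_ne.mem_nhds hu0] with v hv
      simp [n, smul_smul, mul_inv_cancel₀ (norm_ne_zero_iff.2 hv)]
    have := DFunLike.congr_fun ((hnormd.smul hnd).unique h1) e
    simp only [add_apply, hu, one_smul,
      ContinuousLinearMap.smulRight_apply, hc, ContinuousLinearMap.id_apply] at this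
    have hnu : n u = u := by simp [n, hu]
    rw [hnu] at this
    exact eq_sub_of_add_eq this
  have hmem : ∀ e, e - ⟪u, e⟫_ℝ • u ∈ LinearMap.range (G' : E →ₗ[ℝ] E) := by
    intro e
    rw [← hn']
    exact range_fderiv_le_of_comp_eq hG hnd hcompG hx e
  obtain ⟨a, ha⟩ : ∃ a, ρ' a ≠ 0 := by
    by_contra! h
    exact hρ0 (ContinuousLinearMap.ext h)
  -- The range already contains every vector orthogonal to `u`; the vector `G' a` has `u`-component
  -- `ρ' a ≠ 0`, which adds the last direction.
  have huG : u ∈ LinearMap.range (G' : E →ₗ[ℝ] E) := by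
    have h1 : G' a ∈ LinearMap.range (G' : E →ₗ[ℝ] E) := ⟨a, rfl⟩
    have h2 := Submodule.sub_mem _ h1 (hmem (G' a))
    have h3 : ⟪u, G' a⟫_ℝ = ρ' a := by
      rw [real_inner_comm]
      simp [G', inner_add_left, hN'u, inner_smul_left, hu]
    rw [sub_sub_cancel, h3] at h2
    exact (Submodule.smul_mem_iff _ ha).1 h2
  have hsurj : Function.Surjective (G' : E →ₗ[ℝ] E) := by
    intro e
    have := Submodule.add_mem _ (hmem e) (Submodule.smul_mem _ ⟪u, e⟫_ℝ huG)
    rw [sub_add_cancel] at this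
    exact this
  have hinj := LinearMap.injective_iff_surjective.2 hsurj
  let e : E ≃L[ℝ] E := (LinearEquiv.ofBijective (G' : E →ₗ[ℝ] E) ⟨hinj, hsurj⟩).toContinuousLinearEquiv
  have he : HasFDerivAt G (e : E →L[ℝ] E) (x u) := by
    convert! hG using 1
  have hxc : Filter.Tendsto x (𝓝 u) (𝓝 (x u)) := 
    tendsto_sub_nhds_zero_iff.1 (hx.trans_tendsto (tendsto_sub_nhds_zero_iff.2 Filter.tendsto_id))
  -- By the inverse function theorem `x` is, near `u`, the local inverse of `G` after normalization,
  -- hence as smooth as `G`.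
  have hleft := hxc.eventually (hGc.hasStrictFDerivAt' he one_ne_zero).eventually_left_inverse
  have hinv := hGc.to_localInverse he one_ne_zero
  rw [hcompG.self_of_nhds] at hinv
  refine (hinv.comp u (contDiffAt_normalize hu0)).congr_of_eventuallyEq ?_
  filter_upwards [hleft, hcompG] with v h1 h2
  rw [Function.comp_apply, ← h1, h2]
  rfl

end Normalize

/-! ### Support points and the geometry of constant width -/

theorem exists_supportPoint (B : ConvexBody E3) (u : E3) :
    ∃ p ∈ B, ∀ y ∈ B, ⟪y, u⟫_ℝ ≤ ⟪p, u⟫_ℝ := by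
  have hc : Continuous fun y : E3 => ⟪y, u⟫_ℝ := by fun_prop
  exact B.isCompact.exists_isMaxOn B.nonempty hc.continuousOn

/-- A point of `B` at which the linear functional `⟪·, u⟫` is maximal. -/
noncomputable def supportPoint (B : ConvexBody E3) (u : E3) : E3 := (exists_supportPoint B u).choose

theorem supportPoint_mem (B : ConvexBody E3) (u : E3) : supportPoint B u ∈ B :=
  (exists_supportPoint B u).choose_spec.1

theorem inner_le_inner_supportPoint {B : ConvexBody E3} {y : E3} (hy : y ∈ B) (u : E3) :
    ⟪y, u⟫_ℝ ≤ ⟪supportPoint B u, u⟫_ℝ :=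
  (exists_supportPoint B u).choose_spec.2 y hy

theorem supportFn_eq (B : ConvexBody E3) (u : E3) : supportFn B u = ⟪supportPoint B u, u⟫_ℝ := by
  refine IsGreatest.csSup_eq ⟨⟨_, supportPoint_mem B u, rfl⟩, ?_⟩
  rintro _ ⟨y, hy, rfl⟩
  exact inner_le_inner_supportPoint hy u

theorem inner_le_supportFn {B : ConvexBody E3} {y : E3} (hy : y ∈ B) (u : E3) :
    ⟪y, u⟫_ℝ ≤ supportFn B u :=
  (inner_le_inner_supportPoint hy u).trans_eq (supportFn_eq B u).symm

theorem eq_supportFn_of_isMax {B : ConvexBody E3} {u p : E3} (hp : p ∈ B)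
    (hmax : ∀ y ∈ B, ⟪y, u⟫_ℝ ≤ ⟪p, u⟫_ℝ) : ⟪p, u⟫_ℝ = supportFn B u :=
  le_antisymm (inner_le_supportFn hp u) ((supportFn_eq B u).trans_le (hmax _ (supportPoint_mem B u)))

theorem mem_frontier_of_isMax {B : ConvexBody E3} {u p : E3} (hu : u ≠ 0) (hp : p ∈ B)
    (hmax : ∀ y ∈ B, ⟪y, u⟫_ℝ ≤ ⟪p, u⟫_ℝ) : p ∈ frontier (B : Set E3) := by
  rw [B.isCompact.isClosed.frontier_eq]
  refine ⟨hp, fun hint => ?_⟩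
  have hc : Filter.Tendsto (fun t : ℝ => p + t • u) (𝓝[>] 0) (𝓝 p) := by
    have : Filter.Tendsto (fun t : ℝ => p + t • u) (𝓝 0) (𝓝 (p + (0 : ℝ) • u)) :=
      (continuous_const.add (continuous_id.smul continuous_const)).tendsto 0
    rw [zero_smul, add_zero] at this
    exact this.mono_left nhdsWithin_le_nhds
  obtain ⟨t, ht, ht0⟩ := ((hc.eventually (mem_interior_iff_mem_nhds.1 hint)).and
    self_mem_nhdsWithin).exists
  have h1 := hmax _ ht
  rw [inner_add_left, inner_smul_left] at h1
  have h2 : 0 < ⟪u, u⟫_ℝ := real_inner_self_pos.2 hu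
  have h3 : 0 < t := ht0
  have := mul_pos h3 h2
  simp at h1
  simp at this
  linarith

section ConstantWidth

variable {B : ConvexBody E3} {w : ℝ}

/-- The width in the direction of `p - q` is at least the distance of the two points: the diameter
is at most `w`. -/
theorem HasConstantWidth.norm_sub_le_of_ne (hw : HasConstantWidth B w) {p q : E3} (hp : p ∈ B)
    (hq : q ∈ B) (hpq : p ≠ q) : ‖p - q‖ ≤ w := by
  have h0 : ‖p - q‖ ≠ 0 := norm_ne_zero_iff.2 (sub_ne_zero.2 hpq)
  set u : E3 := ‖p - q‖⁻¹ • (p - q) with hu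
  have hu1 : ‖u‖ = 1 := by rw [hu, norm_smul, norm_inv, norm_norm, inv_mul_cancel₀ h0]
  rw [← hw u hu1]
  have h1 := inner_le_supportFn hp u
  have h2 := inner_le_supportFn hq (-u)
  rw [inner_neg_right] at h2
  have h3 : ⟪p - q, u⟫_ℝ = ‖p - q‖ := by
    rw [hu, inner_smul_right, real_inner_self_eq_norm_sq]; field_simp
  rw [inner_sub_left] at h3
  linarith

theorem HasConstantWidth.nonneg (hw : HasConstantWidth B w) : 0 ≤ w := by
  have hu : ‖(EuclideanSpace.single 0 1 : E3)‖ = 1 := by simp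
  rw [← hw _ hu]
  obtain ⟨p, hp⟩ := B.nonempty
  have h1 := inner_le_supportFn hp (EuclideanSpace.single 0 1 : E3)
  have h2 := inner_le_supportFn hp (-(EuclideanSpace.single 0 1 : E3))
  rw [inner_neg_right] at h2
  linarith

theorem HasConstantWidth.norm_sub_le (hw : HasConstantWidth B w) {p q : E3} (hp : p ∈ B)
    (hq : q ∈ B) : ‖p - q‖ ≤ w := by
  rcases eq_or_ne p q with rfl | h
  · simpa using hw.nonneg
  · exact hw.norm_sub_le_of_ne hp hq h

/-- The component of `p - q` along `u` is already `w`, while its length is at most `w`; no room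
remains for a tangential component. -/
theorem HasConstantWidth.sub_eq (hw : HasConstantWidth B w) {u p q : E3} (hu : ‖u‖ = 1)
    (hp : p ∈ B) (hq : q ∈ B) (hpm : ∀ y ∈ B, ⟪y, u⟫_ℝ ≤ ⟪p, u⟫_ℝ)
    (hqm : ∀ y ∈ B, ⟪y, -u⟫_ℝ ≤ ⟪q, -u⟫_ℝ) : p - q = w • u := by
  have h1 := hw u hu
  rw [← eq_supportFn_of_isMax hp hpm, ← eq_supportFn_of_isMax hq hqm, inner_neg_right] at h1
  have h2 := hw.norm_sub_le hp hq
  have h3 : ‖p - q - w • u‖ ^ 2 = ‖p - q‖ ^ 2 - w ^ 2 := by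
    rw [norm_sub_sq_real, inner_smul_right, inner_sub_left, norm_smul, hu, mul_one,
      Real.norm_eq_abs, sq_abs]
    linear_combination (-2 * w) * h1
  have h4 : ‖p - q‖ ^ 2 ≤ w ^ 2 := pow_le_pow_left₀ (norm_nonneg _) h2 2
  have h5 : ‖p - q - w • u‖ ^ 2 = 0 := le_antisymm (by linarith) (sq_nonneg _)
  exact sub_eq_zero.1 (norm_eq_zero.1 (pow_eq_zero_iff two_ne_zero |>.1 h5))

theorem HasConstantWidth.sub_supportPoint_neg (hw : HasConstantWidth B w) {u : E3} (hu : ‖u‖ = 1) :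
    supportPoint B u - supportPoint B (-u) = w • u :=
  hw.sub_eq hu (supportPoint_mem B u) (supportPoint_mem B (-u))
    (fun _ hy => inner_le_inner_supportPoint hy u) fun _ hy => inner_le_inner_supportPoint hy (-u)

/-- All maximizers differ by the same vector from one fixed opposite support point, so they
coincide. -/
theorem HasConstantWidth.eq_supportPoint (hw : HasConstantWidth B w) {u p : E3} (hu : u ≠ 0)
    (hp : p ∈ B) (hpm : ∀ y ∈ B, ⟪y, u⟫_ℝ ≤ ⟪p, u⟫_ℝ) : p = supportPoint B u := by
  have hn : 0 < ‖u‖ := norm_pos_iff.2 hu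
  have hu1 : ‖‖u‖⁻¹ • u‖ = 1 := by rw [norm_smul, norm_inv, norm_norm, inv_mul_cancel₀ hn.ne']
  have key : ∀ q ∈ B, (∀ y ∈ B, ⟪y, u⟫_ℝ ≤ ⟪q, u⟫_ℝ) →
      q - supportPoint B (-(‖u‖⁻¹ • u)) = w • ‖u‖⁻¹ • u := fun q hq hqm =>
    hw.sub_eq hu1 hq (supportPoint_mem B _) (fun y hy => by
      rw [inner_smul_right, inner_smul_right]
      exact mul_le_mul_of_nonneg_left (hqm y hy) (inv_nonneg.2 hn.le))
      fun _ hy => inner_le_inner_supportPoint hy _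
  have := (key p hp hpm).trans (key _ (supportPoint_mem B u)
    fun _ hy => inner_le_inner_supportPoint hy u).symm
  exact sub_left_injective this

theorem HasConstantWidth.supportPoint_smul (hw : HasConstantWidth B w) {u : E3} (hu : u ≠ 0)
    {t : ℝ} (ht : 0 < t) : supportPoint B (t • u) = supportPoint B u := by
  refine hw.eq_supportPoint hu (supportPoint_mem B _) fun y hy => ?_
  have := inner_le_inner_supportPoint hy (t • u)
  rw [inner_smul_right, inner_smul_right] at this
  exact le_of_mul_le_mul_left this ht

/-- A body of constant width `w` is contained in the ball of radius `w` that touches it from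
outside at a support point. -/
theorem HasConstantWidth.norm_sq_le (hw : HasConstantWidth B w) {u y : E3} (hu : ‖u‖ = 1)
    (hy : y ∈ B) :
    ‖y - supportPoint B u‖ ^ 2 ≤ 2 * w * ⟪supportPoint B u - y, u⟫_ℝ := by
  have h1 := hw.sub_supportPoint_neg hu
  have h2 := hw.norm_sub_le hy (supportPoint_mem B (-u))
  have h3 : supportPoint B (-u) = supportPoint B u - w • u := by rw [← h1]; abel
  rw [h3, ← sub_add] at h2
  have h4 := pow_le_pow_left₀ (norm_nonneg _) h2 2
  rw [norm_add_sq_real, inner_smul_right, norm_smul, hu, mul_one, Real.norm_eq_abs, sq_abs] at h4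
  have h5 : ⟪supportPoint B u - y, u⟫_ℝ = -⟪y - supportPoint B u, u⟫_ℝ := by
    rw [← inner_neg_left, neg_sub]
  rw [h5]; linarith

/-- Adding the inequalities for the touching balls at both points gives `‖p - q‖² ≤ w ⟪p - q, u -
v⟫`; then Cauchy–Schwarz. Constant width thus bounds the reverse Gauss map without any curvature
assumption. -/
theorem HasConstantWidth.norm_supportPoint_sub_le (hw : HasConstantWidth B w) {u v : E3}
    (hu : ‖u‖ = 1) (hv : ‖v‖ = 1) : ‖supportPoint B u - supportPoint B v‖ ≤ w * ‖u - v‖ := by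
  have h1 := hw.norm_sq_le hu (supportPoint_mem B v)
  have h2 := hw.norm_sq_le hv (supportPoint_mem B u)
  set p := supportPoint B u
  set q := supportPoint B v
  rw [norm_sub_rev] at h1
  have h3 : ⟪q - p, v⟫_ℝ = -⟪p - q, v⟫_ℝ := by rw [← inner_neg_left, neg_sub]
  rw [h3] at h2
  have h4 : ‖p - q‖ ^ 2 ≤ w * ⟪p - q, u - v⟫_ℝ := by rw [inner_sub_right]; linarith
  have h5 : ‖p - q‖ ^ 2 ≤ w * (‖p - q‖ * ‖u - v‖) :=
    h4.trans (mul_le_mul_of_nonneg_left (real_inner_le_norm _ _) hw.nonneg)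
  rcases eq_or_lt_of_le (norm_nonneg (p - q)) with h | h
  · rw [← h]; exact mul_nonneg hw.nonneg (norm_nonneg _)
  · refine le_of_mul_le_mul_left ?_ h
    linarith

theorem HasConstantWidth.supportPoint_sub_isBigO (hw : HasConstantWidth B w) {u : E3}
    (hu : u ≠ 0) : (fun v => supportPoint B v - supportPoint B u) =O[𝓝 u] fun v => v - u := by
  have h1 : (fun v : E3 => ‖v‖⁻¹ • v - ‖u‖⁻¹ • u) =O[𝓝 u] fun v => v - u :=
    ((contDiffAt_normalize (n := 1) hu).differentiableAt one_ne_zero).isBigO_sub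
  refine Asymptotics.IsBigO.trans (Asymptotics.IsBigO.of_bound w ?_) h1
  have hunit : ∀ v : E3, v ≠ 0 → ‖‖v‖⁻¹ • v‖ = 1 ∧
      supportPoint B (‖v‖⁻¹ • v) = supportPoint B v := fun v hv =>
    have hn : 0 < ‖v‖ := norm_pos_iff.2 hv
    ⟨by rw [norm_smul, norm_inv, norm_norm, inv_mul_cancel₀ hn.ne'],
      hw.supportPoint_smul hv (inv_pos.2 hn)⟩
  filter_upwards [isOpen_ne.mem_nhds hu] with v hv
  rw [← (hunit v hv).2, ← (hunit u hu).2]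
  exact hw.norm_supportPoint_sub_le (hunit v hv).1 (hunit u hu).1

end ConstantWidth

/-! ### The reverse Gauss map is continuously differentiable -/

/-- Lagrange multipliers: `p` maximizes `⟪·, u⟫` locally on the level set of `ρ`. Neither multiplier
vanishes because `u ≠ 0` and the derivative of `ρ` is nonzero. -/
theorem exists_smul_eq_of_isMax {B : ConvexBody E3} {ρ : E3 → ℝ} {u p : E3} (hu : u ≠ 0)
    (hp : p ∈ B) (hmax : ∀ y ∈ B, ⟪y, u⟫_ℝ ≤ ⟪p, u⟫_ℝ) (hρ : ContDiffAt ℝ 2 ρ p)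
    (hρ0 : fderiv ℝ ρ p ≠ 0) (hloc : ∀ᶠ y in 𝓝 p, (y ∈ frontier (B : Set E3) ↔ ρ y = 0)) :
    ∃ k : ℝ, k ≠ 0 ∧ fderiv ℝ ρ p = k • innerSL ℝ u := by
  have hpf := mem_frontier_of_isMax hu hp hmax
  have hρp : ρ p = 0 := hloc.self_of_nhds.1 hpf
  have hext : IsLocalExtrOn (innerSL ℝ u) {y | ρ y = ρ p} p := by
    refine Or.inr ?_
    have : ∀ᶠ y in 𝓝[{y | ρ y = ρ p}] p, innerSL ℝ u y ≤ innerSL ℝ u p := by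
      filter_upwards [hloc.filter_mono nhdsWithin_le_nhds, self_mem_nhdsWithin] with y hy hy'
      have hyf : y ∈ frontier (B : Set E3) := hy.2 (by rw [← hρp]; exact hy')
      have := hmax y (B.isCompact.isClosed.frontier_subset hyf)
      simpa [real_inner_comm] using this
    exact this
  obtain ⟨a, b, hab, h⟩ := hext.exists_multipliers_of_hasStrictFDerivAt_1d
    (hρ.hasStrictFDerivAt two_ne_zero) (innerSL ℝ u).hasStrictFDerivAt
  have ha : a ≠ 0 := by
    rintro rfl
    have hb : b ≠ 0 := by rintro rfl; exact hab rfl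
    have := DFunLike.congr_fun h u
    simp [hb, hu] at this
  have hb : b ≠ 0 := by
    rintro rfl
    simp [ha, hρ0] at h
  refine ⟨-(b / a), neg_ne_zero.2 (div_ne_zero hb ha), ?_⟩
  have h2 : a • fderiv ℝ ρ p = -(b • innerSL ℝ u) := eq_neg_of_add_eq_zero_left h
  have h3 := congrArg (fun T => a⁻¹ • T) h2
  simp only [smul_smul, inv_mul_cancel₀ ha, one_smul, smul_neg] at h3
  rw [h3, neg_smul, div_eq_inv_mul]

/-- The normalized gradient of `ρ` is a `C¹` unit normal field which, composed with the Lipschitz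
map `supportPoint B`, gives `v ↦ ‖v‖⁻¹ • v`; `contDiffAt_of_unitNormal_comp` then applies. -/
theorem contDiffAt_supportPoint {B : ConvexBody E3} {w : ℝ} (hC2 : HasC2Boundary B)
    (hw : HasConstantWidth B w) {u : E3} (hu : ‖u‖ = 1) : ContDiffAt ℝ 1 (supportPoint B) u := by
  have hu0 : u ≠ 0 := by rintro rfl; simp at hu
  have hmax : ∀ v : E3, ∀ y ∈ B, ⟪y, v⟫_ℝ ≤ ⟪supportPoint B v, v⟫_ℝ := fun v y hy =>
    inner_le_inner_supportPoint hy v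
  set p := supportPoint B u with hpdef
  -- The defining function is defined only up to sign; it is replaced by its negative if necessary
  -- so that its gradient at `p` points outwards.
  obtain ⟨ρ, hρ, hρ0, hloc, hpos⟩ : ∃ ρ : E3 → ℝ, ContDiffAt ℝ 2 ρ p ∧ fderiv ℝ ρ p ≠ 0 ∧
      (∀ᶠ y in 𝓝 p, (y ∈ frontier (B : Set E3) ↔ ρ y = 0)) ∧ 0 < fderiv ℝ ρ p u := by
    obtain ⟨ρ, hρ, hρ0, hloc⟩ := hC2 p (mem_frontier_of_isMax hu0 (supportPoint_mem B u) (hmax u))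
    obtain ⟨k, hk, hkρ⟩ := exists_smul_eq_of_isMax hu0 (supportPoint_mem B u) (hmax u) hρ hρ0 hloc
    have hku : fderiv ℝ ρ p u = k := by rw [hkρ]; simp [hu]
    rcases lt_or_gt_of_ne hk with h | h
    · refine ⟨fun y => -ρ y, hρ.neg, ?_, ?_, ?_⟩
      · rw [fderiv_fun_neg]; exact neg_ne_zero.2 hρ0
      · simpa using hloc
      · rw [fderiv_fun_neg, neg_apply, hku]; linarith
    · exact ⟨ρ, hρ, hρ0, hloc, by rw [hku]; exact h⟩
  let grad : E3 → E3 := fun y => (InnerProductSpace.toDual ℝ E3).symm (fderiv ℝ ρ y)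
  have hgrad : ContDiffAt ℝ 1 grad p :=
    (InnerProductSpace.toDual ℝ E3).symm.contDiff.contDiffAt.comp p
      (hρ.fderiv_right (m := 1) (by norm_num))
  have hgrad0 : grad p ≠ 0 := by simpa [grad] using hρ0
  have hN : ContDiffAt ℝ 1 (fun y => ‖grad y‖⁻¹ • grad y) p :=
    (contDiffAt_normalize hgrad0).comp p hgrad
  have hO := hw.supportPoint_sub_isBigO hu0
  have hxc : Filter.Tendsto (supportPoint B) (𝓝 u) (𝓝 p) :=
    tendsto_sub_nhds_zero_iff.1 (hO.trans_tendsto (tendsto_sub_nhds_zero_iff.2 Filter.tendsto_id))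
  have hgc : ContinuousAt grad p := hgrad.continuousAt
  have hg0 : ∀ᶠ y in 𝓝 p, grad y ≠ 0 := hgc.eventually (isOpen_ne.mem_nhds hgrad0)
  have hev : ∀ᶠ v in 𝓝 u, ∃ k : ℝ, k ≠ 0 ∧ fderiv ℝ ρ (supportPoint B v) = k • innerSL ℝ v := by
    filter_upwards [hxc.eventually hg0, hxc.eventually (hρ.eventually (by simp)),
      hxc.eventually hloc.eventually_nhds, isOpen_ne.mem_nhds hu0] with v h1 h2 h3 h4
    exact exists_smul_eq_of_isMax h4 (supportPoint_mem B v) (hmax v) h2 (by simpa [grad] using h1) h3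
  -- Lagrange multipliers leave the sign of the factor open at nearby points. Continuity carries it
  -- over from `u`.
  have hposv : ∀ᶠ v in 𝓝 u, 0 < ⟪grad (supportPoint B v), v⟫_ℝ := by
    have : Filter.Tendsto (fun v => ⟪grad (supportPoint B v), v⟫_ℝ) (𝓝 u) (𝓝 ⟪grad p, u⟫_ℝ) :=
      (hgc.tendsto.comp hxc).inner Filter.tendsto_id
    refine this.eventually (lt_mem_nhds ?_)
    simpa [grad] using hpos
  refine contDiffAt_of_unitNormal_comp hu (hρ.of_le (by norm_num)) hρ0 hN ?_ ?_ ?_ hO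
  · filter_upwards [hg0] with y hy
    rw [norm_smul, norm_inv, norm_norm, inv_mul_cancel₀ (norm_ne_zero_iff.2 hy)]
  · filter_upwards [hev, hposv, isOpen_ne.mem_nhds hu0] with v ⟨k, hk, hkv⟩ h1 h2
    have hgv : grad (supportPoint B v) = k • v := by
      simp only [grad, hkv, map_smulₛₗ]
      congr 1
      exact (InnerProductSpace.toDual ℝ E3).symm_apply_apply v
    rw [hgv, inner_smul_left] at h1
    have hk0 : 0 < k := by
      have := real_inner_self_pos.2 h2
      simp only [conj_trivial] at h1
      exact pos_of_mul_pos_left h1 this.le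
    rw [hgv, norm_smul, Real.norm_of_nonneg hk0.le, smul_smul, mul_inv, mul_comm k⁻¹, mul_assoc,
      inv_mul_cancel₀ hk, mul_one]
  · filter_upwards [hxc.eventually hloc, isOpen_ne.mem_nhds hu0] with v hv h2
    exact hv.1 (mem_frontier_of_isMax h2 (supportPoint_mem B v) (hmax v))

/-! ### Projective hedgehogs and their radii of curvature -/

/-- A `C¹` hedgehog whose parametrization `X` by the unit normal is even: the gradient of an odd
support function, extended to `E3 \ {0}` so that it is homogeneous of degree `0`. -/
structure IsProjectiveHedgehog (X : E3 → E3) : Prop where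
  contDiffAt : ∀ u, u ≠ 0 → ContDiffAt ℝ 1 X u
  smul : ∀ u, u ≠ 0 → ∀ t : ℝ, 0 < t → X (t • u) = X u
  neg : ∀ u, u ≠ 0 → X (-u) = X u
  inner_fderiv : ∀ u, u ≠ 0 → ∀ a, ⟪fderiv ℝ X u a, u⟫_ℝ = 0

/-- The derivative of a hedgehog, extended by the identity in the normal direction. -/
noncomputable def hedgehogDeriv (X : E3 → E3) (u : E3) : E3 →L[ℝ] E3 :=
  fderiv ℝ X u + (innerSL ℝ u).smulRight u

/-- The product of the principal radii of curvature of the hedgehog `X` at the unit normal `u`. -/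
noncomputable def radiiProd (X : E3 → E3) (u : E3) : ℝ := LinearMap.det (hedgehogDeriv X u : E3 →ₗ[ℝ] E3)

namespace IsProjectiveHedgehog

variable {X : E3 → E3}

theorem hasFDerivAt {u : E3} (hX : IsProjectiveHedgehog X) (hu : u ≠ 0) :
    HasFDerivAt X (fderiv ℝ X u) u :=
  ((hX.contDiffAt u hu).differentiableAt one_ne_zero).hasFDerivAt

theorem fderiv_self {u : E3} (hX : IsProjectiveHedgehog X) (hu : u ≠ 0) : fderiv ℝ X u u = 0 := by
  have h1 : HasDerivAt (fun t : ℝ => t • u) u 1 := by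
    simpa using (hasDerivAt_id (1 : ℝ)).smul_const u
  have h2 : HasFDerivAt X (fderiv ℝ X u) ((1 : ℝ) • u) := by simpa using hX.hasFDerivAt hu
  have h3 := h2.comp_hasDerivAt (1 : ℝ) h1
  refine h3.unique ((hasDerivAt_const (1 : ℝ) (X u)).congr_of_eventuallyEq ?_)
  filter_upwards [lt_mem_nhds (zero_lt_one (α := ℝ))] with t ht
  exact hX.smul u hu t ht

/-- As the derivative of `X` is orthogonal to the normal, `v ↦ ⟪X v, v⟫` has gradient `X`. The
derivative of `X` is therefore a Hessian, symmetric although the support function was never assumed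
`C²`. -/
theorem inner_fderiv_comm {u : E3} (hX : IsProjectiveHedgehog X) (hu : u ≠ 0) (a b : E3) :
    ⟪fderiv ℝ X u a, b⟫_ℝ = ⟪fderiv ℝ X u b, a⟫_ℝ := by
  have h1 : ∀ᶠ v in 𝓝 u, HasFDerivAt (fun v => ⟪X v, v⟫_ℝ) (innerSL ℝ (X v)) v := by
    filter_upwards [isOpen_ne.mem_nhds hu] with v hv
    have := (hX.hasFDerivAt hv).inner ℝ (hasFDerivAt_id v)
    refine this.congr_fderiv ?_
    ext e
    simp [hX.inner_fderiv v hv e]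
  have h2 : HasFDerivAt (fun v => innerSL ℝ (X v)) ((innerSL ℝ).comp (fderiv ℝ X u)) u :=
    (innerSL ℝ : E3 →L[ℝ] E3 →L[ℝ] ℝ).hasFDerivAt.comp u (hX.hasFDerivAt hu)
  exact second_derivative_symmetric_of_eventually h1 h2 a b

end IsProjectiveHedgehog

/-- The decomposition of `E3` into the tangent plane and the normal line of the unit sphere at
`sphereDir ξ`. -/
noncomputable def tangentNormalEquiv (ξ : ℂ) : (ℂ × ℝ) ≃ₗ[ℝ] E3 where
  toFun q := fderiv ℝ sphereDir ξ q.1 + q.2 • sphereDir ξ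
  invFun p := (lineCoord ξ p, ⟪p, sphereDir ξ⟫_ℝ)
  map_add' p q := by simp [add_smul]; abel
  map_smul' t p := by
    rw [Prod.smul_fst, Prod.smul_snd, map_smul, smul_eq_mul, mul_smul, ← smul_add]; rfl
  left_inv q := by
    have h : ⟪sphereDir ξ, sphereDir ξ⟫_ℝ = 1 := by
      rw [real_inner_self_eq_norm_sq, norm_sphereDir, one_pow]
    ext1
    · simp [fderiv_sphereDir, lineCoord_lineFoot, lineCoord_sphereDir]
    · simp only [inner_add_left, inner_smul_left, fderiv_sphereDir, inner_lineFoot_sphereDir, h]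
      simp
  right_inv p := by simp [fderiv_sphereDir, lineFoot_lineCoord]

theorem Complex.det_realLinearMap (M : ℂ →ₗ[ℝ] ℂ) :
    LinearMap.det M = (M 1).re * (M Complex.I).im - (M 1).im * (M Complex.I).re := by
  rw [← LinearMap.det_toMatrix Complex.basisOneI, Matrix.det_fin_two]
  simp [LinearMap.toMatrix_apply]
  ring

/-- The derivative of `X` at `sphereDir ξ` in the coordinate `ξ`. -/
noncomputable def coordDeriv (X : E3 → E3) (ξ : ℂ) : ℂ →L[ℝ] ℂ :=
  (lineCoord ξ).comp ((fderiv ℝ X (sphereDir ξ)).comp (fderiv ℝ sphereDir ξ))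

namespace IsProjectiveHedgehog

variable {X : E3 → E3}

theorem lineFoot_coordDeriv (hX : IsProjectiveHedgehog X) (ξ η : ℂ) :
    lineFoot ξ (coordDeriv X ξ η) = fderiv ℝ (fun ζ => X (sphereDir ζ)) ξ η := by
  rw [fderiv_fun_comp ξ ((hX.contDiffAt _ (sphereDir_ne_zero ξ)).differentiableAt one_ne_zero)
    ((contDiff_sphereDir (n := 1)).differentiable one_ne_zero ξ)]
  exact lineFoot_lineCoord_of_inner_eq_zero (hX.inner_fderiv _ (sphereDir_ne_zero ξ) _)

/-- In the splitting into tangent plane and normal line the extended derivative is block diagonal,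
with blocks `coordDeriv X ξ` and `1`. -/
theorem radiiProd_sphereDir (hX : IsProjectiveHedgehog X) (ξ : ℂ) :
    radiiProd X (sphereDir ξ) = (coordDeriv X ξ 1).re * (coordDeriv X ξ Complex.I).im -
      (coordDeriv X ξ 1).im * (coordDeriv X ξ Complex.I).re := by
  have hU := sphereDir_ne_zero ξ
  have h : (hedgehogDeriv X (sphereDir ξ) : E3 →ₗ[ℝ] E3) =
      (tangentNormalEquiv ξ : (ℂ × ℝ) →ₗ[ℝ] E3) ∘ₗ
        (LinearMap.prodMap (coordDeriv X ξ : ℂ →ₗ[ℝ] ℂ) LinearMap.id) ∘ₗ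
        ((tangentNormalEquiv ξ).symm : E3 →ₗ[ℝ] ℂ × ℝ) := by
    ext1 p
    obtain ⟨q, rfl⟩ := (tangentNormalEquiv ξ).surjective p
    have h1 : ⟪sphereDir ξ, sphereDir ξ⟫_ℝ = 1 := by
      rw [real_inner_self_eq_norm_sq, norm_sphereDir, one_pow]
    have h2 : ∀ q, tangentNormalEquiv ξ q = lineFoot ξ q.1 + q.2 • sphereDir ξ := fun q => by
      rw [← fderiv_sphereDir]; rfl
    simp only [LinearMap.comp_apply, LinearEquiv.coe_coe, LinearEquiv.symm_apply_apply]
    rw [h2, h2]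
    simp only [LinearMap.prodMap_apply, LinearMap.id_apply, ContinuousLinearMap.coe_coe,
      hedgehogDeriv, add_apply, ContinuousLinearMap.smulRight_apply, innerSL_apply_apply,
      h1, map_add, map_smul, hX.fderiv_self hU]
    rw [real_inner_comm, inner_lineFoot_sphereDir]
    have h3 : lineFoot ξ (coordDeriv X ξ q.1) = fderiv ℝ X (sphereDir ξ) (lineFoot ξ q.1) := by
      rw [← fderiv_sphereDir ξ q.1]
      exact lineFoot_lineCoord_of_inner_eq_zero (hX.inner_fderiv _ hU _)
    rw [h3]; simp
  rw [radiiProd, h, LinearMap.det_conj, LinearMap.det_prodMap, LinearMap.det_id, mul_one,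
    Complex.det_realLinearMap]
  rfl

/-- Stereographic projection is conformal, so self-adjointness for the metric of the sphere is
symmetry of the matrix in the coordinate `ξ`. -/
theorem coordDeriv_symm (hX : IsProjectiveHedgehog X) (ξ : ℂ) :
    (coordDeriv X ξ 1).im = (coordDeriv X ξ Complex.I).re := by
  have hU := sphereDir_ne_zero ξ
  have h := hX.inner_fderiv_comm hU (lineFoot ξ 1) (lineFoot ξ Complex.I)
  have h3 : ∀ η, lineFoot ξ (coordDeriv X ξ η) = fderiv ℝ X (sphereDir ξ) (lineFoot ξ η) := by
    intro η
    rw [← fderiv_sphereDir ξ η]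
    exact lineFoot_lineCoord_of_inner_eq_zero (hX.inner_fderiv _ hU _)
  rw [← h3, ← h3, inner_lineFoot_lineFoot, inner_lineFoot_lineFoot] at h
  have hp : 4 / (1 + ‖ξ‖ ^ 2) ^ 2 ≠ 0 := by positivity
  simpa using mul_right_cancel₀ hp h

end IsProjectiveHedgehog

/-! ### The slopes `ψ` and `σ` in terms of the derivative of the hedgehog -/

/-- `lineCoord ζ p` is a complex polynomial in `ζ`, so the motion of the frame contributes
multiplication by a complex number. Such a term enters `ψ` but drops out of `σ`. -/
theorem hasFDerivAt_lineCoord_comp {Z : ℂ → E3} {Z' : ℂ →L[ℝ] E3} {ξ : ℂ}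
    (hZ : HasFDerivAt Z Z' ξ) :
    HasFDerivAt (fun ζ => lineCoord ζ (Z ζ)) ((lineCoord ξ).comp Z' -
      (((Z ξ 0 : ℂ) - Complex.I * Z ξ 1) * ξ + Z ξ 2) • ContinuousLinearMap.id ℝ ℂ) ξ := by
  have hi : ∀ i, HasFDerivAt (fun ζ => ((Z ζ i : ℝ) : ℂ))
      (Complex.ofRealCLM.comp ((EuclideanSpace.proj i : E3 →L[ℝ] ℝ).comp Z')) ξ := fun i =>
    Complex.ofRealCLM.hasFDerivAt.comp ξ ((EuclideanSpace.proj i : E3 →L[ℝ] ℝ).hasFDerivAt.comp ξ hZ)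
  have hid := hasFDerivAt_id (𝕜 := ℝ) ξ
  have h := (((hi 0).mul ((((hid.mul hid).const_sub 1)).mul_const (1 / 2))).add
    ((hi 1).mul ((((hid.mul hid).const_add 1)).mul_const (Complex.I / 2)))).add
    ((hi 2).mul hid.neg)
  refine (h.congr_fderiv ?_).congr_of_eventuallyEq (Filter.Eventually.of_forall fun ζ => ?_)
  · refine ContinuousLinearMap.ext fun η => ?_
    simp [lineCoord_apply]; ring
  · simp [lineCoord_apply]; ring

theorem hasFDerivAt_one_add_norm_sq_sq (ξ : ℂ) :
    HasFDerivAt (fun ζ : ℂ => (((1 + ‖ζ‖ ^ 2) ^ 2 : ℝ) : ℂ))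
      (Complex.ofRealCLM.comp ((2 * (1 + ‖ξ‖ ^ 2)) • (2 • innerSL ℝ ξ))) ξ := by
  have h1 := ((hasStrictFDerivAt_norm_sq ξ).hasFDerivAt.const_add 1).pow 2
  have h2 := Complex.ofRealCLM.hasFDerivAt.comp ξ h1
  refine h2.congr_fderiv ?_
  refine ContinuousLinearMap.ext fun η => ?_
  simp
  ring

theorem dXi_div_one_add_norm_sq_sq {F : ℂ → ℂ} {F' : ℂ →L[ℝ] ℂ} {ξ : ℂ} (hF : HasFDerivAt F F' ξ) :
    (((1 + ‖ξ‖ ^ 2) ^ 2 : ℝ) : ℂ) * dXi (fun ζ => F ζ / (((1 + ‖ζ‖ ^ 2) ^ 2 : ℝ) : ℂ)) ξ =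
      (F' 1 - Complex.I * F' Complex.I) / 2 -
        2 * conj ξ * F ξ / (((1 + ‖ξ‖ ^ 2 : ℝ)) : ℂ) := by
  have hs : (0 : ℝ) < 1 + ‖ξ‖ ^ 2 := by positivity
  have hs0 : ((1 + ‖ξ‖ ^ 2 : ℝ) : ℂ) ≠ 0 := by exact_mod_cast hs.ne'
  have hg0 : (((1 + ‖ξ‖ ^ 2) ^ 2 : ℝ) : ℂ) ≠ 0 := by exact_mod_cast (pow_pos hs 2).ne'
  set Q : ℂ → ℂ := fun ζ => F ζ / (((1 + ‖ζ‖ ^ 2) ^ 2 : ℝ) : ℂ) with hQ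
  have hg := hasFDerivAt_one_add_norm_sq_sq ξ
  have hQd : HasFDerivAt Q (fderiv ℝ Q ξ) ξ :=
    (hF.differentiableAt.mul (DifferentiableAt.inv hg.differentiableAt hg0)).hasFDerivAt
  -- Differentiating the product that recovers `F` from `Q`, and comparing with `F'`, replaces the
  -- quotient rule.
  have hF2 : HasFDerivAt F _ ξ := (hg.mul hQd).congr_of_eventuallyEq
    (Filter.Eventually.of_forall fun ζ => by
      have h : (((1 + ‖ζ‖ ^ 2) ^ 2 : ℝ) : ℂ) ≠ 0 := by
        have : (0 : ℝ) < (1 + ‖ζ‖ ^ 2) ^ 2 := by positivity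
        exact_mod_cast this.ne'
      exact (mul_div_cancel₀ (F ζ) h).symm)
  have hQξ : Q ξ * (((1 + ‖ξ‖ ^ 2) ^ 2 : ℝ) : ℂ) = F ξ := div_mul_cancel₀ _ hg0
  have h1 : ∀ η : ℂ, ⟪ξ, η⟫_ℝ = ξ.re * η.re + ξ.im * η.im := fun η => by
    rw [Complex.inner]; simp; ring
  have h2 : conj ξ = ξ.re - Complex.I * ξ.im := by apply Complex.ext <;> simp
  rw [hF.unique hF2, dXi, h2, ← hQξ]
  simp only [add_apply, smul_apply, ContinuousLinearMap.comp_apply, Complex.ofRealCLM_apply,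
    innerSL_apply_apply, h1, smul_eq_mul, Complex.one_re, Complex.one_im, Complex.I_re,
    Complex.I_im, nsmul_eq_mul]
  push_cast at hs0 ⊢
  field_simp
  ring

/-- The correction from the moving frame and that from the weight `(1 + |ξ|²)²` in `ψ` add up to the
support value. This is why `r` has to be added to `ψ`. -/
theorem lineCoord_normal_part (ξ : ℂ) (p : E3) :
    ((p 0 : ℂ) - Complex.I * p 1) * ξ + p 2 +
      2 * conj ξ * lineCoord ξ p / (((1 + ‖ξ‖ ^ 2 : ℝ)) : ℂ) = (⟪p, sphereDir ξ⟫_ℝ : ℝ) := by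
  have hp := one_add_sq_add_sq_pos ξ.re ξ.im
  rw [Complex.norm_sq_eq_re_im, E3.inner_eq, sphereDir_apply_zero, sphereDir_apply_one,
    sphereDir_apply_two]
  apply Complex.ext
  · rw [Complex.add_re, Complex.div_ofReal_re, Complex.ofReal_re]
    simp only [Complex.mul_re, Complex.mul_im, lineCoord_re, lineCoord_im]
    simp
    field_simp
    ring
  · rw [Complex.add_im, Complex.div_ofReal_im, Complex.ofReal_im]
    simp only [Complex.mul_re, Complex.mul_im, lineCoord_re, lineCoord_im]
    simp
    field_simp
    ring

namespace IsProjectiveHedgehog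

variable {X : E3 → E3}

theorem contDiff_comp_sphereDir (hX : IsProjectiveHedgehog X) :
    ContDiff ℝ 1 fun ζ => X (sphereDir ζ) :=
  contDiff_iff_contDiffAt.2 fun ξ =>
    (hX.contDiffAt _ (sphereDir_ne_zero ξ)).comp ξ contDiff_sphereDir.contDiffAt

theorem hasFDerivAt_lineCoord (hX : IsProjectiveHedgehog X) (ξ : ℂ) :
    HasFDerivAt (fun ζ => lineCoord ζ (X (sphereDir ζ))) (coordDeriv X ξ -
      (((X (sphereDir ξ) 0 : ℂ) - Complex.I * X (sphereDir ξ) 1) * ξ + X (sphereDir ξ) 2) •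
        ContinuousLinearMap.id ℝ ℂ) ξ := by
  refine hasFDerivAt_lineCoord_comp (Z := fun ζ => X (sphereDir ζ)) ?_
  exact (hX.hasFDerivAt (sphereDir_ne_zero ξ)).comp ξ
    ((contDiff_sphereDir (n := 1)).differentiable one_ne_zero ξ).hasFDerivAt

theorem contDiff_lineCoord (hX : IsProjectiveHedgehog X) :
    ContDiff ℝ 1 fun ζ => lineCoord ζ (X (sphereDir ζ)) := by
  have hi : ∀ i, ContDiff ℝ 1 fun ζ => ((X (sphereDir ζ) i : ℝ) : ℂ) := fun i =>
    Complex.ofRealCLM.contDiff.comp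
      ((EuclideanSpace.proj i : E3 →L[ℝ] ℝ).contDiff.comp hX.contDiff_comp_sphereDir)
  simp only [lineCoord_apply]
  exact (((hi 0).mul (by fun_prop)).add ((hi 1).mul (by fun_prop))).add
    ((hi 2).mul contDiff_id.neg)

theorem slopePsi_eq (hX : IsProjectiveHedgehog X) (ξ : ℂ) :
    slopePsi (fun ζ => lineCoord ζ (X (sphereDir ζ))) ξ =
      (coordDeriv X ξ 1 - Complex.I * coordDeriv X ξ Complex.I) / 2 -
        (⟪X (sphereDir ξ), sphereDir ξ⟫_ℝ : ℝ) := by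
  rw [slopePsi, dXi_div_one_add_norm_sq_sq (hX.hasFDerivAt_lineCoord ξ),
    ← lineCoord_normal_part ξ (X (sphereDir ξ))]
  simp only [sub_apply, smul_apply, ContinuousLinearMap.id_apply, smul_eq_mul]
  linear_combination ((((X (sphereDir ξ) 0 : ℂ) - Complex.I * X (sphereDir ξ) 1) * ξ +
    X (sphereDir ξ) 2) / 2) * Complex.I_sq

theorem slopeSigma_eq (hX : IsProjectiveHedgehog X) (ξ : ℂ) :
    slopeSigma (fun ζ => lineCoord ζ (X (sphereDir ζ))) ξ =
      -(conj (coordDeriv X ξ 1) - Complex.I * conj (coordDeriv X ξ Complex.I)) / 2 := by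
  have h : HasFDerivAt (fun ζ => conj (lineCoord ζ (X (sphereDir ζ)))) _ ξ :=
    (Complex.conjCLE : ℂ →L[ℝ] ℂ).hasFDerivAt.comp ξ (hX.hasFDerivAt_lineCoord ξ)
  rw [slopeSigma, dXi, h.fderiv]
  set k := ((X (sphereDir ξ) 0 : ℂ) - Complex.I * X (sphereDir ξ) 1) * ξ + X (sphereDir ξ) 2
  have h1 : ∀ z, (Complex.conjCLE : ℂ →L[ℝ] ℂ) z = conj z := fun z => rfl
  simp only [ContinuousLinearMap.comp_apply, h1, sub_apply, smul_apply, ContinuousLinearMap.id_apply,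
    smul_eq_mul, map_sub, map_mul, map_one, Complex.conj_I]
  linear_combination (conj k / 2) * Complex.I_sq

theorem slopePsi_im (hX : IsProjectiveHedgehog X) (ξ : ℂ) :
    (slopePsi (fun ζ => lineCoord ζ (X (sphereDir ζ))) ξ).im = 0 := by
  rw [hX.slopePsi_eq]
  have := hX.coordDeriv_symm ξ
  simp [this]

/-- For a symmetric `2 × 2` matrix, the squared half trace minus the squared norm `((a - d)² +
4b²)/4` of the trace-free part is the determinant. The two terms are `(⟪X, u⟫ + ψ)²` and `|σ|²`. -/
theorem norm_slopeSigma_sq_sub (hX : IsProjectiveHedgehog X) (ξ : ℂ) :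
    ‖slopeSigma (fun ζ => lineCoord ζ (X (sphereDir ζ))) ξ‖ ^ 2 -
      (⟪X (sphereDir ξ), sphereDir ξ⟫_ℝ +
        (slopePsi (fun ζ => lineCoord ζ (X (sphereDir ζ))) ξ).re) ^ 2 =
      -radiiProd X (sphereDir ξ) := by
  rw [hX.slopePsi_eq, hX.slopeSigma_eq, hX.radiiProd_sphereDir, Complex.norm_sq_eq_re_im]
  have := hX.coordDeriv_symm ξ
  simp [this]
  ring

end IsProjectiveHedgehog

/-! ### The hedgehog of a body of constant width -/

/-- The parametrization by the unit normal of the boundary of a body of constant width `w`,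
recentred so that parallel tangent planes have opposite support values. -/
noncomputable def centredSupportPoint (B : ConvexBody E3) (w : ℝ) (u : E3) : E3 :=
  supportPoint B u - (w / 2) • ‖u‖⁻¹ • u

section ConstantWidth

variable {B : ConvexBody E3} {w : ℝ}

/-- Evenness is `x(u) - x(-u) = w u`. The derivative is orthogonal to `u` because, for fixed `u`,
both `⟪supportPoint B v, u⟫` and `⟪‖v‖⁻¹ • v, u⟫` are maximal at `v = u`. -/
theorem isProjectiveHedgehog_centredSupportPoint (hC2 : HasC2Boundary B)
    (hw : HasConstantWidth B w) : IsProjectiveHedgehog (centredSupportPoint B w) := by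
  have hunit : ∀ v : E3, v ≠ 0 → ‖‖v‖⁻¹ • v‖ = 1 ∧
      supportPoint B (‖v‖⁻¹ • v) = supportPoint B v := fun v hv =>
    have hn : 0 < ‖v‖ := norm_pos_iff.2 hv
    ⟨by rw [norm_smul, norm_inv, norm_norm, inv_mul_cancel₀ hn.ne'],
      hw.supportPoint_smul hv (inv_pos.2 hn)⟩
  have hsp : ∀ u : E3, u ≠ 0 → ContDiffAt ℝ 1 (supportPoint B) u := fun u hu => by
    refine (ContDiffAt.comp (f := fun v : E3 => ‖v‖⁻¹ • v) u
      (contDiffAt_supportPoint hC2 hw (hunit u hu).1)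
      (contDiffAt_normalize hu)).congr_of_eventuallyEq ?_
    filter_upwards [isOpen_ne.mem_nhds hu] with v hv
    exact (hunit v hv).2.symm
  have hcd : ∀ u : E3, u ≠ 0 → ContDiffAt ℝ 1 (centredSupportPoint B w) u := fun u hu =>
    (hsp u hu).sub ((contDiffAt_normalize hu).const_smul (w / 2))
  refine ⟨hcd, fun u hu t ht => ?_, fun u hu => ?_, fun u hu a => ?_⟩
  · rw [centredSupportPoint, hw.supportPoint_smul hu ht, norm_smul, Real.norm_of_nonneg ht.le,
      mul_inv, mul_comm t⁻¹, smul_smul (‖u‖⁻¹ * t⁻¹), inv_mul_cancel_right₀ ht.ne',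
      centredSupportPoint]
  · have h := hw.sub_supportPoint_neg (hunit u hu).1
    have h1 : supportPoint B (-(‖u‖⁻¹ • u)) = supportPoint B (-u) := by
      have := (hunit (-u) (neg_ne_zero.2 hu)).2
      rwa [norm_neg, smul_neg] at this
    rw [h1, (hunit u hu).2] at h
    rw [centredSupportPoint, centredSupportPoint, norm_neg, smul_neg, smul_neg, sub_neg_eq_add,
      eq_sub_iff_add_eq, add_assoc, ← add_smul, add_halves, ← h]
    abel
  · have hd1 := ((hsp u hu).differentiableAt one_ne_zero).hasFDerivAt
    have hd2 : HasFDerivAt (fun v : E3 => ‖v‖⁻¹ • v) _ u :=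
      ((contDiffAt_normalize (n := 1) hu).differentiableAt one_ne_zero).hasFDerivAt
    have hmax : ∀ (Y : E3 → E3) (Y' : E3 →L[ℝ] E3), HasFDerivAt Y Y' u →
        (∀ᶠ v in 𝓝 u, ⟪Y v, u⟫_ℝ ≤ ⟪Y u, u⟫_ℝ) → ⟪Y' a, u⟫_ℝ = 0 := fun Y Y' hY hm => by
      have h := IsLocalMax.hasFDerivAt_eq_zero hm (hY.inner ℝ (hasFDerivAt_const u u))
      simpa using DFunLike.congr_fun h a
    have h1 := hmax _ _ hd1 (Filter.Eventually.of_forall fun v =>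
      inner_le_inner_supportPoint (supportPoint_mem B v) u)
    have h2 := hmax _ _ hd2 (by
      filter_upwards [isOpen_ne.mem_nhds hu] with v hv
      refine (real_inner_le_norm _ _).trans ?_
      rw [(hunit v hv).1, inner_smul_left, real_inner_self_eq_norm_sq]
      have : ‖u‖ ≠ 0 := norm_ne_zero_iff.2 hu
      simp
      field_simp
      rfl)
    have h3 : HasFDerivAt (centredSupportPoint B w) _ u := hd1.sub (hd2.const_smul (w / 2))
    rw [h3.fderiv, sub_apply, smul_apply, inner_sub_left, inner_smul_left, h1, h2]
    simp

theorem lineCoord_centredSupportPoint (B : ConvexBody E3) (w : ℝ) (ξ : ℂ) :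
    lineCoord ξ (centredSupportPoint B w (sphereDir ξ)) =
      lineCoord ξ (supportPoint B (sphereDir ξ)) := by
  rw [centredSupportPoint, map_sub, map_smul, map_smul, lineCoord_sphereDir]
  simp

theorem inner_centredSupportPoint (B : ConvexBody E3) (w : ℝ) (ξ : ℂ) :
    ⟪centredSupportPoint B w (sphereDir ξ), sphereDir ξ⟫_ℝ = supportCoord B ξ - w / 2 := by
  rw [centredSupportPoint, inner_sub_left, supportCoord, supportFn_eq, norm_sphereDir, inv_one,
    one_smul, inner_smul_left, real_inner_self_eq_norm_sq, norm_sphereDir]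
  simp

/-- Uniqueness of the support point fixes the normal line, and subtracting a multiple of `u` moves
the point along that line only. -/
theorem isNormalCongruence_iff (hw : HasConstantWidth B w) {F : ℂ → ℂ} :
    IsNormalCongruence B F ↔ F = fun ξ => lineCoord ξ (centredSupportPoint B w (sphereDir ξ)) := by
  constructor
  · intro h
    funext ξ
    obtain ⟨s, hs, hmax⟩ := h ξ
    rw [lineCoord_centredSupportPoint, ← hw.eq_supportPoint (sphereDir_ne_zero ξ) hs hmax,
      linePoint, map_add, map_smul, lineCoord_lineFoot, lineCoord_sphereDir]
    simp
  · rintro rfl ξ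
    refine ⟨⟪supportPoint B (sphereDir ξ), sphereDir ξ⟫_ℝ, ?_⟩
    simp only [linePoint, lineCoord_centredSupportPoint, lineFoot_lineCoord]
    exact ⟨supportPoint_mem B _, fun y hy => inner_le_inner_supportPoint hy _⟩

theorem widthIntegrand_eq (hC2 : HasC2Boundary B) (hw : HasConstantWidth B w) (ξ : ℂ) :
    widthIntegrand B w (fun ζ => lineCoord ζ (centredSupportPoint B w (sphereDir ζ))) ξ =
      -(radiiProd (centredSupportPoint B w) (sphereDir ξ) * (4 / (1 + ‖ξ‖ ^ 2) ^ 2)) := by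
  rw [widthIntegrand, ← inner_centredSupportPoint,
    (isProjectiveHedgehog_centredSupportPoint hC2 hw).norm_slopeSigma_sq_sub, neg_mul]

end ConstantWidth

/-! ### Integration over the sphere through integration over the ball -/

/-- The complex number formed by the first two coordinates. -/
noncomputable def planeCoord : E3 →L[ℝ] ℂ :=
  (EuclideanSpace.proj 0 : E3 →L[ℝ] ℝ).smulRight (1 : ℂ) +
    (EuclideanSpace.proj 1 : E3 →L[ℝ] ℝ).smulRight Complex.I

theorem planeCoord_re (p : E3) : (planeCoord p).re = p 0 := by simp [planeCoord]

theorem planeCoord_im (p : E3) : (planeCoord p).im = p 1 := by simp [planeCoord]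

/-- Euclidean 3-space as the product of the horizontal plane and the vertical line. -/
noncomputable def planeProdEquiv : E3 ≃L[ℝ] ℂ × ℝ :=
  LinearEquiv.toContinuousLinearEquiv
    { toFun := fun p => (planeCoord p, p 2)
      invFun := fun q => pointOf q.1 q.2
      map_add' := fun p q => by simp
      map_smul' := fun t p => by simp
      left_inv := fun p => E3.ext_three (planeCoord_re p) (planeCoord_im p) rfl
      right_inv := fun q => Prod.ext (Complex.ext (planeCoord_re _) (planeCoord_im _)) rfl }

/-- Fubini, with `c` supplied by uniqueness of Haar measure. Only its positivity matters, since only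
the sign and the vanishing of integrals are at stake. -/
theorem exists_setIntegral_planeCoord_mul : ∃ c : ℝ, 0 < c ∧ ∀ (f : ℂ → ℝ) (g : ℝ → ℝ) (T : Set ℝ),
    ∫ p in {p : E3 | p 2 ∈ T}, f (planeCoord p) * g (p 2) =
      c * ((∫ z, f z) * ∫ t in T, g t) := by
  let e : E3 ≃ᵐ ℂ × ℝ := planeProdEquiv.toHomeomorph.toMeasurableEquiv
  have hA : (Measure.map planeProdEquiv (volume : Measure E3)).IsAddHaarMeasure :=
    ContinuousLinearEquiv.isAddHaarMeasure_map _ _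
  let ν : Measure (ℂ × ℝ) := (volume : Measure ℂ).prod volume
  have h1 := Measure.isAddLeftInvariant_eq_smul (Measure.map planeProdEquiv (volume : Measure E3)) ν
  have h2 := Measure.addHaarScalarFactor_pos_of_isAddHaarMeasure
    (Measure.map planeProdEquiv (volume : Measure E3)) ν
  set c := Measure.addHaarScalarFactor (Measure.map planeProdEquiv (volume : Measure E3)) ν
  refine ⟨c, by exact_mod_cast h2, fun f g T => ?_⟩
  have h3 := setIntegral_map_equiv (μ := (volume : Measure E3)) e (fun q => f q.1 * g q.2)
    (Set.univ ×ˢ T)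
  have h4 : Measure.map e (volume : Measure E3) = c • ν := h1
  have h5 : e ⁻¹' (Set.univ ×ˢ T) = {p : E3 | p 2 ∈ T} := by
    ext p
    have : e p = (planeCoord p, p 2) := rfl
    simp [this]
  rw [h4, h5, Measure.restrict_smul, integral_smul_nnreal_measure, setIntegral_prod_mul,
    Measure.restrict_univ] at h3
  exact h3.symm

theorem sphereDir_eq_of_norm_eq_one {u : E3} (hu : ‖u‖ = 1) (h2 : u 2 ≠ -1) :
    sphereDir (planeCoord u / ((1 + u 2 : ℝ) : ℂ)) = u := by
  have h1 : u 0 * u 0 + u 1 * u 1 + u 2 * u 2 = 1 := by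
    rw [← E3.inner_eq, real_inner_self_eq_norm_sq, hu, one_pow]
  have hne : 1 + u 2 ≠ 0 := fun h => h2 (by linarith)
  have hre : (planeCoord u / ((1 + u 2 : ℝ) : ℂ)).re = u 0 / (1 + u 2) := by
    rw [Complex.div_ofReal_re, planeCoord_re]
  have him : (planeCoord u / ((1 + u 2 : ℝ) : ℂ)).im = u 1 / (1 + u 2) := by
    rw [Complex.div_ofReal_im, planeCoord_im]
  have hs : 1 + ((u 0 / (1 + u 2)) ^ 2 + (u 1 / (1 + u 2)) ^ 2) = 2 / (1 + u 2) := by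
    field_simp
    linear_combination h1
  apply E3.ext_three
  · rw [sphereDir_apply_zero, hre, him, hs]; field_simp
  · rw [sphereDir_apply_one, hre, him, hs]; field_simp
  · rw [sphereDir_apply_two, hre, him, hs]
    have : 1 - ((u 0 / (1 + u 2)) ^ 2 + (u 1 / (1 + u 2)) ^ 2) = 2 - 2 / (1 + u 2) := by
      rw [← hs]; ring
    rw [this]; field_simp; ring

theorem sphereDir_injective : Function.Injective sphereDir := by
  have key : ∀ ξ, planeCoord (sphereDir ξ) / ((1 + sphereDir ξ 2 : ℝ) : ℂ) = ξ := by
    intro ξ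
    have hp := one_add_sq_add_sq_pos ξ.re ξ.im
    have hs : 1 + sphereDir ξ 2 = 2 / (1 + (ξ.re ^ 2 + ξ.im ^ 2)) := by
      rw [sphereDir_apply_two]; field_simp; ring
    apply Complex.ext
    · rw [Complex.div_ofReal_re, planeCoord_re, hs, sphereDir_apply_zero]; field_simp
    · rw [Complex.div_ofReal_im, planeCoord_im, hs, sphereDir_apply_one]; field_simp
  intro ξ ζ h
  rw [← key ξ, ← key ζ, h]

/-- Polar coordinates of `E3`, with the stereographic coordinate on the sphere in the first two
variables and the radius in the third. -/
noncomputable def stereoPolar (p : E3) : E3 := p 2 • sphereDir (planeCoord p)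

/-- The derivative of `stereoPolar`. -/
noncomputable def stereoPolarDeriv (p : E3) : E3 →L[ℝ] E3 :=
  p 2 • (fderiv ℝ sphereDir (planeCoord p)).comp planeCoord +
    (EuclideanSpace.proj 2 : E3 →L[ℝ] ℝ).smulRight (sphereDir (planeCoord p))

theorem hasFDerivAt_stereoPolar (p : E3) : HasFDerivAt stereoPolar (stereoPolarDeriv p) p :=
  (EuclideanSpace.proj 2 : E3 →L[ℝ] ℝ).hasFDerivAt.smul
    (((contDiff_sphereDir (n := 1)).differentiable one_ne_zero _).hasFDerivAt.comp p
      planeCoord.hasFDerivAt)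

theorem det_stereoPolarDeriv (p : E3) : (stereoPolarDeriv p).det =
    p 2 ^ 2 * (4 / (1 + ‖planeCoord p‖ ^ 2) ^ 2) := by
  have happ : ∀ q i, stereoPolarDeriv p q i =
      p 2 * lineFoot (planeCoord p) (planeCoord q) i + q 2 * sphereDir (planeCoord p) i := by
    intro q i
    simp [stereoPolarDeriv, fderiv_sphereDir]
  have hp := one_add_sq_add_sq_pos (planeCoord p).re (planeCoord p).im
  rw [ContinuousLinearMap.det, ← LinearMap.det_toMatrix (EuclideanSpace.basisFun (Fin 3) ℝ).toBasis,
    Matrix.det_fin_three]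
  simp only [LinearMap.toMatrix_apply, OrthonormalBasis.coe_toBasis_repr_apply,
    OrthonormalBasis.coe_toBasis, EuclideanSpace.basisFun_repr, EuclideanSpace.basisFun_apply,
    ContinuousLinearMap.coe_coe, happ, lineFoot_apply_zero, lineFoot_apply_one, lineFoot_apply_two,
    sphereDir_apply_zero, sphereDir_apply_one, sphereDir_apply_two, Complex.norm_sq_eq_re_im]
  generalize (planeCoord p).re = x at *
  generalize (planeCoord p).im = y at *
  simp only [planeCoord_re, planeCoord_im, PiLp.single_apply]
  simp
  field_simp
  ring

theorem norm_stereoPolar {p : E3} (hp : 0 < p 2) : ‖stereoPolar p‖ = p 2 := by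
  rw [stereoPolar, norm_smul, norm_sphereDir, mul_one, Real.norm_of_nonneg hp.le]

theorem injOn_stereoPolar : Set.InjOn stereoPolar {p : E3 | p 2 ∈ Set.Ioo (0 : ℝ) 1} := by
  intro p hp q hq h
  have h2 : p 2 = q 2 := by rw [← norm_stereoPolar hp.1, ← norm_stereoPolar hq.1, h]
  have h3 : planeCoord p = planeCoord q := by
    rw [stereoPolar, stereoPolar, ← h2] at h
    exact sphereDir_injective (smul_right_injective _ (ne_of_gt hp.1) h)
  exact planeProdEquiv.injective (Prod.ext h3 h2)

theorem stereoPolar_image_ae_eq :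
    (stereoPolar '' {p : E3 | p 2 ∈ Set.Ioo (0 : ℝ) 1} : Set E3) =ᵐ[volume] Metric.ball (0 : E3) 1 := by
  refine (Filter.eventuallyLE_antisymm_iff.2 ⟨?_, ?_⟩)
  · refine Filter.Eventually.of_forall fun x hx => ?_
    obtain ⟨p, hp, rfl⟩ := hx
    show stereoPolar p ∈ Metric.ball (0 : E3) 1
    rw [mem_ball_zero_iff, norm_stereoPolar hp.1]
    exact hp.2
  · have hnull : volume (LinearMap.ker ((EuclideanSpace.proj 0 : E3 →L[ℝ] ℝ) : E3 →ₗ[ℝ] ℝ) : Set E3)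
        = 0 := by
      refine Measure.addHaar_submodule _ _ fun h => ?_
      have : (EuclideanSpace.single 0 1 : E3) ∈
          LinearMap.ker ((EuclideanSpace.proj 0 : E3 →L[ℝ] ℝ) : E3 →ₗ[ℝ] ℝ) := by rw [h]; trivial
      simp at this
    filter_upwards [compl_mem_ae_iff.2 hnull] with x hx hxb
    have hx0 : x 0 ≠ 0 := hx
    have hxn : x ≠ 0 := by rintro rfl; exact hx0 rfl
    have hn : 0 < ‖x‖ := norm_pos_iff.2 hxn
    set u : E3 := ‖x‖⁻¹ • x with hu
    have hu1 : ‖u‖ = 1 := by rw [hu, norm_smul, norm_inv, norm_norm, inv_mul_cancel₀ hn.ne']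
    have hu2 : u 2 ≠ -1 := by
      intro h2
      have h1 : u 0 * u 0 + u 1 * u 1 + u 2 * u 2 = 1 := by
        rw [← E3.inner_eq, real_inner_self_eq_norm_sq, hu1, one_pow]
      have hu0 : u 0 ≠ 0 := by
        rw [hu, PiLp.smul_apply, smul_eq_mul]; exact mul_ne_zero (inv_ne_zero hn.ne') hx0
      rw [h2] at h1
      have := mul_self_pos.2 hu0
      have := mul_self_nonneg (u 1)
      linarith
    refine ⟨pointOf (planeCoord u / ((1 + u 2 : ℝ) : ℂ)) ‖x‖, ⟨hn, mem_ball_zero_iff.1 hxb⟩, ?_⟩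
    have h3 : ∀ z t, planeCoord (pointOf z t) = z := fun z t =>
      Complex.ext (planeCoord_re _) (planeCoord_im _)
    rw [stereoPolar, h3, sphereDir_eq_of_norm_eq_one hu1 hu2, pointOf_apply_two, hu, smul_smul,
      mul_inv_cancel₀ hn.ne', one_smul]

/-- Integration over the unit sphere in the stereographic coordinate agrees, up to a constant, with
integration of a function of the direction over the unit ball. -/
theorem exists_setIntegral_ball_direction : ∃ κ : ℝ, 0 < κ ∧ ∀ f : E3 → ℝ,
    ∫ x in Metric.ball (0 : E3) 1, f (‖x‖⁻¹ • x) =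
      κ * ∫ ξ : ℂ, f (sphereDir ξ) * (4 / (1 + ‖ξ‖ ^ 2) ^ 2) := by
  obtain ⟨c, hc, h⟩ := exists_setIntegral_planeCoord_mul
  -- The factor `1 / 3` is the radial integral of `t²` over `(0, 1)`.
  refine ⟨c * (1 / 3), by positivity, fun f => ?_⟩
  have hS : MeasurableSet {p : E3 | p 2 ∈ Set.Ioo (0 : ℝ) 1} :=
    measurableSet_Ioo.preimage (EuclideanSpace.proj 2 : E3 →L[ℝ] ℝ).continuous.measurable
  rw [← setIntegral_congr_set stereoPolar_image_ae_eq,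
    integral_image_eq_integral_abs_det_fderiv_smul volume hS
      (fun p _ => (hasFDerivAt_stereoPolar p).hasFDerivWithinAt) injOn_stereoPolar]
  have h1 : ∫ t in Set.Ioo (0 : ℝ) 1, t ^ 2 = 1 / 3 := by
    rw [← integral_Ioc_eq_integral_Ioo, ← intervalIntegral.integral_of_le zero_le_one, integral_pow]
    norm_num
  rw [mul_assoc, mul_comm (1 / 3), ← h1, ← h (fun ξ => f (sphereDir ξ) * (4 / (1 + ‖ξ‖ ^ 2) ^ 2))]
  refine setIntegral_congr_fun hS fun p hp => ?_
  have hp0 : 0 < p 2 := hp.1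
  have h2 : ‖stereoPolar p‖⁻¹ • stereoPolar p = sphereDir (planeCoord p) := by
    rw [norm_stereoPolar hp0, stereoPolar, smul_smul, inv_mul_cancel₀ hp0.ne', one_smul]
  simp only [det_stereoPolarDeriv, h2, smul_eq_mul]
  rw [abs_of_nonneg (by positivity)]
  ring

/-! ### Wirtinger's inequality -/

/-- `f ε` is of order `ε` and the cotangent of order `1/ε`, so the product is of order `ε`. These
are the boundary terms of the integration below. -/
theorem tendsto_sq_mul_cot_zero {f : ℝ → ℝ} {f' : ℝ} (hf : HasDerivAt f f' 0) (h0 : f 0 = 0) :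
    Filter.Tendsto (fun ε => f ε ^ 2 * (Real.cos ε / Real.sin ε)) (𝓝[>] 0) (𝓝 0) := by
  have hle : 𝓝[>] (0 : ℝ) ≤ 𝓝[≠] 0 := nhdsWithin_mono _ fun x hx => ne_of_gt hx
  have h1 : Filter.Tendsto (fun ε => ε⁻¹ * f ε) (𝓝[>] 0) (𝓝 f') := by
    have := (hasDerivAt_iff_tendsto_slope_zero.1 hf).mono_left hle
    simpa [h0] using this
  have h2 : Filter.Tendsto (fun ε => ε⁻¹ * Real.sin ε) (𝓝[>] 0) (𝓝 1) := by
    have := (hasDerivAt_iff_tendsto_slope_zero.1 (Real.hasDerivAt_sin 0)).mono_left hle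
    simpa using this
  have h3 : Filter.Tendsto f (𝓝[>] 0) (𝓝 0) := by
    have := hf.continuousAt.tendsto.mono_left (nhdsWithin_le_nhds (s := Set.Ioi 0))
    rwa [h0] at this
  have h4 : Filter.Tendsto Real.cos (𝓝[>] 0) (𝓝 1) := by
    have := Real.continuous_cos.continuousAt.tendsto.mono_left (nhdsWithin_le_nhds (a := 0)
      (s := Set.Ioi 0))
    rwa [Real.cos_zero] at this
  have h5 := (h3.mul (h1.mul (h2.inv₀ one_ne_zero))).mul h4
  rw [zero_mul, zero_mul] at h5
  refine h5.congr' ?_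
  filter_upwards [self_mem_nhdsWithin] with ε hε
  have : ε ≠ 0 := ne_of_gt hε
  rw [mul_inv, inv_inv]
  field_simp

/-- Jacobi's trick: `(ρ² cot)' = (τ² - ρ²) - (τ - ρ cot)²`, integrated over `[ε, π - ε]` with `ε →
0`. The square is kept only on `[a, b]`, which avoids its integrability at the endpoints. -/
theorem integral_sq_sub_cot_le {ρ τ : ℝ → ℝ} (hρ : ∀ θ, HasDerivAt ρ (τ θ) θ) (hτ : Continuous τ)
    (h0 : ρ 0 = 0) (hπ : ρ Real.pi = 0) {a b : ℝ} (ha : 0 < a) (hab : a < b) (hb : b < Real.pi) :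
    ∫ θ in a..b, (τ θ - ρ θ * (Real.cos θ / Real.sin θ)) ^ 2 ≤
      ∫ θ in (0 : ℝ)..Real.pi, (τ θ ^ 2 - ρ θ ^ 2) := by
  have hρc : Continuous ρ := continuous_iff_continuousAt.2 fun θ => (hρ θ).continuousAt
  have hsin : ∀ θ, 0 < θ → θ < Real.pi → Real.sin θ ≠ 0 := fun θ h1 h2 =>
    (Real.sin_pos_of_pos_of_lt_pi h1 h2).ne'
  have hcont : ∀ c d : ℝ, 0 < c → c ≤ d → d < Real.pi → IntervalIntegrable
      (fun θ => (τ θ - ρ θ * (Real.cos θ / Real.sin θ)) ^ 2) volume c d := by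
    intro c d hc hcd hd
    refine ContinuousOn.intervalIntegrable ?_
    rw [Set.uIcc_of_le hcd]
    refine (hτ.continuousOn.sub (hρc.continuousOn.mul
      (Real.continuous_cos.continuousOn.div Real.continuous_sin.continuousOn fun θ hθ => ?_))).pow 2
    exact hsin θ (hc.trans_le hθ.1) (hθ.2.trans_lt hd)
  have hmain : ∀ ε, 0 < ε → ε < a → b < Real.pi - ε →
      (∫ θ in a..b, (τ θ - ρ θ * (Real.cos θ / Real.sin θ)) ^ 2) +
        (-(ρ (Real.pi - ε) ^ 2 * (Real.cos ε / Real.sin ε)) -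
          ρ ε ^ 2 * (Real.cos ε / Real.sin ε)) ≤
        ∫ θ in ε..(Real.pi - ε), (τ θ ^ 2 - ρ θ ^ 2) := by
    intro ε hε hεa hεb
    have hle : ε ≤ Real.pi - ε := by linarith
    have hlt : Real.pi - ε < Real.pi := by linarith
    have hG : ∀ θ ∈ Set.uIcc ε (Real.pi - ε), HasDerivAt
        (fun θ => ρ θ ^ 2 * (Real.cos θ / Real.sin θ))
        ((τ θ ^ 2 - ρ θ ^ 2) - (τ θ - ρ θ * (Real.cos θ / Real.sin θ)) ^ 2) θ := by
      intro θ hθ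
      rw [Set.uIcc_of_le hle] at hθ
      have hs := hsin θ (hε.trans_le hθ.1) (hθ.2.trans_lt hlt)
      refine (((hρ θ).pow 2).mul
        ((Real.hasDerivAt_cos θ).div (Real.hasDerivAt_sin θ) hs)).congr_deriv ?_
      simp only [Nat.cast_ofNat, Nat.add_one_sub_one, pow_one, Pi.pow_apply, Pi.div_apply]
      field_simp
      ring
    have hint1 : IntervalIntegrable (fun θ => τ θ ^ 2 - ρ θ ^ 2) volume ε (Real.pi - ε) :=
      ((hτ.pow 2).sub (hρc.pow 2)).intervalIntegrable _ _
    have hint2 := hcont ε (Real.pi - ε) hε hle hlt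
    have h1 := intervalIntegral.integral_eq_sub_of_hasDerivAt hG (hint1.sub hint2)
    rw [intervalIntegral.integral_sub hint1 hint2, Real.cos_pi_sub, Real.sin_pi_sub, neg_div,
      mul_neg] at h1
    have h2 := intervalIntegral.integral_mono_interval hεa.le hab.le hεb.le
      (Filter.Eventually.of_forall fun θ => sq_nonneg (τ θ - ρ θ * (Real.cos θ / Real.sin θ))) hint2
    linarith
  have hl1 : Filter.Tendsto (fun ε => ρ ε ^ 2 * (Real.cos ε / Real.sin ε)) (𝓝[>] 0) (𝓝 0) :=
    tendsto_sq_mul_cot_zero (hρ 0) h0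
  have hl2 : Filter.Tendsto (fun ε => ρ (Real.pi - ε) ^ 2 * (Real.cos ε / Real.sin ε))
      (𝓝[>] 0) (𝓝 0) := by
    refine tendsto_sq_mul_cot_zero (f := fun ε => ρ (Real.pi - ε)) (f' := -τ Real.pi) ?_ (by simpa)
    have h1 : HasDerivAt ρ (τ Real.pi) (Real.pi - 0) := by rw [sub_zero]; exact hρ _
    exact (h1.comp (0 : ℝ) ((hasDerivAt_id (0 : ℝ)).const_sub Real.pi)).congr_deriv (by simp)
  have hl3 : Filter.Tendsto (fun ε => ∫ θ in ε..(Real.pi - ε), (τ θ ^ 2 - ρ θ ^ 2)) (𝓝[>] 0)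
      (𝓝 (∫ θ in (0 : ℝ)..Real.pi, (τ θ ^ 2 - ρ θ ^ 2))) := by
    have hc : Continuous (fun θ => τ θ ^ 2 - ρ θ ^ 2) := (hτ.pow 2).sub (hρc.pow 2)
    have h1 : Continuous fun ε : ℝ => ∫ θ in ε..(Real.pi - ε), (τ θ ^ 2 - ρ θ ^ 2) := by
      have hp := intervalIntegral.continuous_primitive
        (fun a b => hc.intervalIntegrable (μ := volume) a b) 0
      have : (fun ε : ℝ => ∫ θ in ε..(Real.pi - ε), (τ θ ^ 2 - ρ θ ^ 2)) = fun ε =>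
          (∫ θ in (0 : ℝ)..(Real.pi - ε), (τ θ ^ 2 - ρ θ ^ 2)) -
            ∫ θ in (0 : ℝ)..ε, (τ θ ^ 2 - ρ θ ^ 2) := by
        funext ε
        rw [intervalIntegral.integral_interval_sub_left (hc.intervalIntegrable _ _)
          (hc.intervalIntegrable _ _)]
      rw [this]
      exact (hp.comp (continuous_const.sub continuous_id)).sub hp
    have := (h1.tendsto 0).mono_left (nhdsWithin_le_nhds (s := Set.Ioi 0))
    simpa using this
  have hl4 := (tendsto_const_nhds (x := ∫ θ in a..b, (τ θ - ρ θ * (Real.cos θ / Real.sin θ)) ^ 2)).add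
    (hl2.neg.sub hl1)
  rw [neg_zero, sub_zero, add_zero] at hl4
  refine le_of_tendsto_of_tendsto hl4 hl3 ?_
  have e1 : ∀ᶠ ε in 𝓝[>] (0 : ℝ), ε < a := nhdsWithin_le_nhds (gt_mem_nhds ha)
  have e2 : ∀ᶠ ε in 𝓝[>] (0 : ℝ), ε < Real.pi - b := nhdsWithin_le_nhds (gt_mem_nhds (by linarith))
  filter_upwards [self_mem_nhdsWithin, e1, e2] with ε h1 h2 h3
  exact hmain ε h1 h2 (by linarith)

theorem integral_sq_le_of_zero {ρ τ : ℝ → ℝ} (hρ : ∀ θ, HasDerivAt ρ (τ θ) θ) (hτ : Continuous τ)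
    (h0 : ρ 0 = 0) (hπ : ρ Real.pi = 0) :
    0 ≤ (∫ θ in (0 : ℝ)..Real.pi, (τ θ ^ 2 - ρ θ ^ 2)) ∧
      ((∫ θ in (0 : ℝ)..Real.pi, (τ θ ^ 2 - ρ θ ^ 2)) = 0 →
        ∃ k : ℝ, ∀ θ ∈ Set.Icc 0 Real.pi, ρ θ = k * Real.sin θ) := by
  have hpi := Real.pi_pos
  have hρc : Continuous ρ := continuous_iff_continuousAt.2 fun θ => (hρ θ).continuousAt
  constructor
  · refine le_trans ?_ (integral_sq_sub_cot_le hρ hτ h0 hπ (a := Real.pi / 3) (b := Real.pi / 2)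
      (by positivity) (by linarith) (by linarith))
    exact intervalIntegral.integral_nonneg (by linarith) fun θ _ => sq_nonneg _
  · intro hz
    have hsin : ∀ θ, 0 < θ → θ < Real.pi → Real.sin θ ≠ 0 := fun θ h1 h2 =>
      (Real.sin_pos_of_pos_of_lt_pi h1 h2).ne'
    -- A nonzero value at `θ` would make the integral of the square over `[θ, (θ + π)/2]` positive.
    -- Its vanishing says that `ρ / sin` has derivative zero.
    have key : ∀ θ ∈ Set.Ioo 0 Real.pi, τ θ * Real.sin θ - ρ θ * Real.cos θ = 0 := by
      intro θ hθ
      by_contra hne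
      have hlt : θ < (θ + Real.pi) / 2 := by linarith [hθ.2]
      have hlt2 : (θ + Real.pi) / 2 < Real.pi := by linarith [hθ.2]
      have h1 := integral_sq_sub_cot_le hρ hτ h0 hπ hθ.1 hlt hlt2
      rw [hz] at h1
      refine absurd h1 (not_le.2 (intervalIntegral.integral_pos hlt ?_
        (fun _ _ => sq_nonneg _) ⟨θ, ⟨le_rfl, hlt.le⟩, ?_⟩))
      · refine (hτ.continuousOn.sub (hρc.continuousOn.mul
          (Real.continuous_cos.continuousOn.div Real.continuous_sin.continuousOn
            fun x hx => ?_))).pow 2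
        exact hsin x (hθ.1.trans_le hx.1) (hx.2.trans_lt hlt2)
      · refine sq_pos_of_ne_zero fun h => hne ?_
        have hs := hsin θ hθ.1 hθ.2
        field_simp at h
        linear_combination h
    refine ⟨ρ (Real.pi / 2), fun θ hθ => ?_⟩
    rcases eq_or_lt_of_le hθ.1 with h1 | h1
    · rw [← h1, h0, Real.sin_zero, mul_zero]
    rcases eq_or_lt_of_le hθ.2 with h2 | h2
    · rw [h2, hπ, Real.sin_pi, mul_zero]
    have hd : ∀ x ∈ Set.Ioo 0 Real.pi, HasDerivAt (fun x => ρ x / Real.sin x) 0 x := fun x hx => by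
      refine ((hρ x).div (Real.hasDerivAt_sin x) (hsin x hx.1 hx.2)).congr_deriv ?_
      rw [key x hx, zero_div]
    have hconst := isOpen_Ioo.is_const_of_deriv_eq_zero isPreconnected_Ioo
      (fun x hx => (hd x hx).differentiableAt.differentiableWithinAt)
      (fun x hx => (hd x hx).deriv) (⟨h1, h2⟩ : θ ∈ Set.Ioo 0 Real.pi)
      (⟨by linarith, by linarith⟩ : Real.pi / 2 ∈ Set.Ioo 0 Real.pi)
    simp only [Real.sin_pi_div_two, div_one] at hconst
    rw [← hconst, div_mul_cancel₀ _ (hsin θ h1 h2)]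

/-- Wirtinger's inequality for antiperiodic functions, with its case of equality. -/
theorem Function.Antiperiodic.integral_sq_le {ρ τ : ℝ → ℝ} (hanti : Function.Antiperiodic ρ Real.pi)
    (hρ : ∀ θ, HasDerivAt ρ (τ θ) θ) (hτ : Continuous τ) :
    0 ≤ (∫ θ in (-Real.pi)..Real.pi, (τ θ ^ 2 - ρ θ ^ 2)) ∧
      ((∫ θ in (-Real.pi)..Real.pi, (τ θ ^ 2 - ρ θ ^ 2)) = 0 → ∀ θ, HasDerivAt τ (-ρ θ) θ) := by
  have hpi := Real.pi_pos
  have hρc : Continuous ρ := continuous_iff_continuousAt.2 fun θ => (hρ θ).continuousAt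
  have hτanti : ∀ θ, τ (θ + Real.pi) = -τ θ := fun θ => by
    have h1 : HasDerivAt (fun θ => ρ (θ + Real.pi)) (τ (θ + Real.pi)) θ :=
      (hρ (θ + Real.pi)).comp_add_const θ Real.pi
    have h2 : HasDerivAt (fun θ => ρ (θ + Real.pi)) (-τ θ) θ :=
      (hρ θ).neg.congr_of_eventuallyEq (Filter.Eventually.of_forall hanti)
    exact h1.unique h2
  have hc : Continuous fun θ => τ θ ^ 2 - ρ θ ^ 2 := (hτ.pow 2).sub (hρc.pow 2)
  have hper : Function.Periodic (fun θ => τ θ ^ 2 - ρ θ ^ 2) Real.pi := fun θ => by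
    simp only [hτanti θ, hanti θ, neg_sq]
  -- Antiperiodicity gives a sign change on `[0, π]`; translating to a zero `θ₀` reduces the problem
  -- to zero boundary values.
  obtain ⟨θ₀, hθ₀⟩ : ∃ θ₀, ρ θ₀ = 0 := by
    have h1 : ρ Real.pi = -ρ 0 := by simpa using hanti 0
    have h2 : (0 : ℝ) ∈ Set.uIcc (ρ 0) (ρ Real.pi) := by
      rw [h1, Set.mem_uIcc]
      rcases le_total 0 (ρ 0) with h | h
      · right; constructor <;> linarith
      · left; constructor <;> linarith
    obtain ⟨θ, -, h⟩ := intermediate_value_uIcc hρc.continuousOn h2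
    exact ⟨θ, h⟩
  have hint : ∫ θ in (-Real.pi)..Real.pi, (τ θ ^ 2 - ρ θ ^ 2) =
      2 * ∫ θ in (0 : ℝ)..Real.pi, (τ (θ + θ₀) ^ 2 - ρ (θ + θ₀) ^ 2) := by
    have h1 := intervalIntegral.integral_add_adjacent_intervals
      (hc.intervalIntegrable (μ := volume) (-Real.pi) 0) (hc.intervalIntegrable 0 Real.pi)
    have h2 := hper.intervalIntegral_add_eq (-Real.pi) θ₀
    have h3 := hper.intervalIntegral_add_eq 0 θ₀
    have h4 := intervalIntegral.integral_comp_add_right (a := 0) (b := Real.pi)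
      (fun θ => τ θ ^ 2 - ρ θ ^ 2) θ₀
    rw [neg_add_cancel] at h2
    rw [zero_add] at h3 h4
    rw [add_comm Real.pi θ₀] at h4
    rw [← h1, h2, h3, h4]
    ring
  have hshift : ∀ θ, HasDerivAt (fun θ => ρ (θ + θ₀)) (τ (θ + θ₀)) θ := fun θ =>
    (hρ (θ + θ₀)).comp_add_const θ θ₀
  obtain ⟨hnn, heq⟩ := integral_sq_le_of_zero hshift (hτ.comp (continuous_id.add continuous_const))
    (by simpa using hθ₀) (by rw [add_comm, hanti, hθ₀, neg_zero])
  rw [hint]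
  refine ⟨by linarith, fun hz => ?_⟩
  obtain ⟨k, hk⟩ := heq (by linarith)
  have hall : ∀ θ, ρ (θ + θ₀) = k * Real.sin θ := by
    intro θ
    -- Both functions are antiperiodic, so the absolute value of their difference is periodic and
    -- the identity extends from one period to the line.
    have hp : Function.Periodic (fun θ => |ρ (θ + θ₀) - k * Real.sin θ|) Real.pi := fun θ => by
      show |ρ (θ + Real.pi + θ₀) - k * Real.sin (θ + Real.pi)| = _
      rw [add_right_comm, hanti, Real.sin_add_pi, ← abs_neg]
      congr 1; ring
    obtain ⟨y, hy, hyθ⟩ := hp.exists_mem_Ico₀ hpi θ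
    simp only [hk y ⟨hy.1, hy.2.le⟩, sub_self, abs_zero, abs_eq_zero] at hyθ
    exact sub_eq_zero.1 hyθ
  have hall' : ∀ θ, ρ θ = k * Real.sin (θ - θ₀) := fun θ => by
    rw [← hall, sub_add_cancel]
  have hτ' : ∀ θ, τ θ = k * Real.cos (θ - θ₀) := fun θ => by
    have h1 : HasDerivAt ρ (k * Real.cos (θ - θ₀)) θ :=
      (((Real.hasDerivAt_sin (θ - θ₀)).comp_sub_const θ θ₀).const_mul k).congr_of_eventuallyEq
        (Filter.Eventually.of_forall hall')
    exact (hρ θ).unique h1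
  intro θ
  refine ((((Real.hasDerivAt_cos (θ - θ₀)).comp_sub_const θ θ₀).const_mul k).congr_of_eventuallyEq
    (Filter.Eventually.of_forall hτ')).congr_deriv ?_
  rw [hall', mul_neg]

/-! ### Area of planar projective hedgehogs -/

/-- The area enclosed by a planar projective hedgehog is nonpositive. -/
theorem integral_mul_deriv_le_of_hedgehog {a b a' b' : ℝ → ℝ} (ha : ∀ θ, HasDerivAt a (a' θ) θ)
    (hb : ∀ θ, HasDerivAt b (b' θ) θ) (hb' : Continuous b')
    (hpa : Function.Periodic a Real.pi) (hpb : Function.Periodic b Real.pi)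
    (horth : ∀ θ, a' θ * Real.cos θ + b' θ * Real.sin θ = 0) :
    (∫ θ in (-Real.pi)..Real.pi, a θ * b' θ) ≤ 0 ∧
      ((∫ θ in (-Real.pi)..Real.pi, a θ * b' θ) = 0 → ∀ θ φ, a θ = a φ ∧ b θ = b φ) := by
  have hac : Continuous a := continuous_iff_continuousAt.2 fun θ => (ha θ).continuousAt
  have hbc : Continuous b := continuous_iff_continuousAt.2 fun θ => (hb θ).continuousAt
  -- `ρ` is the support function, `τ` its derivative, and `κ = ρ + ρ''` the signed radius of
  -- curvature.
  let ρ : ℝ → ℝ := fun θ => a θ * Real.cos θ + b θ * Real.sin θ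
  let τ : ℝ → ℝ := fun θ => b θ * Real.cos θ - a θ * Real.sin θ
  let κ : ℝ → ℝ := fun θ => b' θ * Real.cos θ - a' θ * Real.sin θ
  have hρ : ∀ θ, HasDerivAt ρ (τ θ) θ := fun θ => by
    refine (((ha θ).mul (Real.hasDerivAt_cos θ)).add
      ((hb θ).mul (Real.hasDerivAt_sin θ))).congr_deriv ?_
    linear_combination horth θ
  have hτ : ∀ θ, HasDerivAt τ (κ θ - ρ θ) θ := fun θ => by
    refine (((hb θ).mul (Real.hasDerivAt_cos θ)).sub
      ((ha θ).mul (Real.hasDerivAt_sin θ))).congr_deriv ?_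
    simp only [κ, ρ]; ring
  have hτc : Continuous τ := continuous_iff_continuousAt.2 fun θ => (hτ θ).continuousAt
  have hρc : Continuous ρ := continuous_iff_continuousAt.2 fun θ => (hρ θ).continuousAt
  have hanti : Function.Antiperiodic ρ Real.pi := fun θ => by
    simp only [ρ, hpa θ, hpb θ, Real.cos_add_pi, Real.sin_add_pi]; ring
  have ha'κ : ∀ θ, a' θ = -κ θ * Real.sin θ := fun θ => by
    have h := Real.sin_sq_add_cos_sq θ
    simp only [κ]
    linear_combination (Real.cos θ) * horth θ - a' θ * h
  have hb'κ : ∀ θ, b' θ = κ θ * Real.cos θ := fun θ => by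
    have h := Real.sin_sq_add_cos_sq θ
    simp only [κ]
    linear_combination (Real.sin θ) * horth θ - b' θ * h
  -- Twice the area form differs from `ρ² - τ²` by the derivative of a periodic function, so its
  -- integral is minus the Wirtinger integral.
  have hE : ∀ θ, HasDerivAt (fun θ => τ θ * ρ θ + a θ * b θ)
      (2 * (a θ * b' θ) + (τ θ ^ 2 - ρ θ ^ 2)) θ := fun θ => by
    refine (((hτ θ).mul (hρ θ)).add ((ha θ).mul (hb θ))).congr_deriv ?_
    rw [ha'κ, hb'κ]
    simp only [ρ, τ]
    ring
  have hD : Continuous fun θ => τ θ ^ 2 - ρ θ ^ 2 := (hτc.pow 2).sub (hρc.pow 2)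
  have hint : (∫ θ in (-Real.pi)..Real.pi, a θ * b' θ) =
      -(1 / 2) * ∫ θ in (-Real.pi)..Real.pi, (τ θ ^ 2 - ρ θ ^ 2) := by
    have hi1 : IntervalIntegrable (fun θ => 2 * (a θ * b' θ)) volume (-Real.pi) Real.pi :=
      (continuous_const.mul (hac.mul hb')).intervalIntegrable _ _
    have hi2 := hD.intervalIntegrable (μ := volume) (-Real.pi) Real.pi
    have h1 := intervalIntegral.integral_eq_sub_of_hasDerivAt (fun θ _ => hE θ) (hi1.add hi2)
    have e1 : a Real.pi = a (-Real.pi) := by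
      rw [← hpa (-Real.pi), neg_add_cancel, ← zero_add Real.pi, hpa]
    have e2 : b Real.pi = b (-Real.pi) := by
      rw [← hpb (-Real.pi), neg_add_cancel, ← zero_add Real.pi, hpb]
    have e3 : ρ Real.pi = ρ (-Real.pi) := by
      simp only [ρ, e1, e2, Real.cos_neg, Real.sin_neg, Real.sin_pi]; ring
    have e4 : τ Real.pi = τ (-Real.pi) := by
      simp only [τ, e1, e2, Real.cos_neg, Real.sin_neg, Real.sin_pi]; ring
    rw [e1, e2, e3, e4, sub_self, intervalIntegral.integral_add hi1 hi2,
      intervalIntegral.integral_const_mul] at h1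
    linarith
  obtain ⟨hnn, heq⟩ := hanti.integral_sq_le hρ hτc
  rw [hint]
  refine ⟨by linarith, fun hz => ?_⟩
  -- Equality in Wirtinger gives `τ' = -ρ`, whereas `τ' = κ - ρ` always; so the curve has zero
  -- velocity.
  have hκ : ∀ θ, κ θ = 0 := fun θ => by
    have := (hτ θ).unique (heq (by linarith) θ)
    linarith
  intro θ φ
  exact ⟨is_const_of_deriv_eq_zero (fun θ => (ha θ).differentiableAt)
      (fun θ => by rw [(ha θ).deriv, ha'κ, hκ]; simp) θ φ,
    is_const_of_deriv_eq_zero (fun θ => (hb θ).differentiableAt)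
      (fun θ => by rw [(hb θ).deriv, hb'κ, hκ]; simp) θ φ⟩

/-! ### Green's formula for `C¹` maps of the disc -/

/-- The difference quotient of a `C¹` function as a continuous function of the increment. -/
theorem sub_eq_mul_integral_deriv {f f' : ℝ → ℝ} (hf : ∀ x, HasDerivAt f (f' x) x)
    (hf' : Continuous f') (x h : ℝ) :
    f (x + h) - f x = h * ∫ s in (0 : ℝ)..1, f' (x + s * h) := by
  have h1 : ∀ s : ℝ, HasDerivAt (fun s => f (x + s * h)) (f' (x + s * h) * h) s := fun s => by
    have h2 : HasDerivAt (fun s : ℝ => x + s * h) h s := by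
      simpa using ((hasDerivAt_id s).mul_const h).const_add x
    exact (hf _).comp s h2
  have h3 := intervalIntegral.integral_eq_sub_of_hasDerivAt (a := 0) (b := 1) (fun s _ => h1 s)
    (((hf'.comp (continuous_const.add (continuous_id.mul continuous_const))).mul
      continuous_const).intervalIntegrable _ _)
  rw [intervalIntegral.integral_mul_const] at h3
  simp only [one_mul, zero_mul, add_zero] at h3
  rw [← h3, mul_comm]

section SweptArea

variable {A B A₁ A₂ B₁ B₂ : ℝ → ℝ → ℝ} {c d : ℝ}

/-- The derivative of the area enclosed by a family of closed `C¹` curves. -/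
theorem hasDerivAt_integral_mul_deriv
    (hA₁ : ∀ r θ, HasDerivAt (fun r => A r θ) (A₁ r θ) r)
    (hA₂ : ∀ r θ, HasDerivAt (A r) (A₂ r θ) θ)
    (hB₁ : ∀ r θ, HasDerivAt (fun r => B r θ) (B₁ r θ) r)
    (hB₂ : ∀ r θ, HasDerivAt (B r) (B₂ r θ) θ)
    (cA₁ : Continuous A₁.uncurry) (cA₂ : Continuous A₂.uncurry)
    (cB₁ : Continuous B₁.uncurry) (cB₂ : Continuous B₂.uncurry)
    (hA : ∀ r, A r c = A r d) (hB : ∀ r, B r c = B r d) (r : ℝ) :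
    HasDerivAt (fun r => ∫ θ in c..d, A r θ * B₂ r θ)
      (∫ θ in c..d, (A₁ r θ * B₂ r θ - A₂ r θ * B₁ r θ)) r := by
  have cA : ∀ r, Continuous (A r) := fun r =>
    continuous_iff_continuousAt.2 fun θ => (hA₂ r θ).continuousAt
  have cB : ∀ r, Continuous (B r) := fun r =>
    continuous_iff_continuousAt.2 fun θ => (hB₂ r θ).continuousAt
  have cB₂' : ∀ r, Continuous (B₂ r) := fun r => cB₂.comp (Continuous.prodMk_right r)
  have cA₂' : ∀ r, Continuous (A₂ r) := fun r => cA₂.comp (Continuous.prodMk_right r)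
  -- The averages `qA`, `qB` extend the difference quotients continuously to `h = 0`, so the limit
  -- follows from continuity of a parametric integral.
  let qA : ℝ → ℝ → ℝ := fun h θ => ∫ s in (0 : ℝ)..1, A₁ (r + s * h) θ
  let qB : ℝ → ℝ → ℝ := fun h θ => ∫ s in (0 : ℝ)..1, B₁ (r + s * h) θ
  have hqA : ∀ h θ, A (r + h) θ - A r θ = h * qA h θ := fun h θ =>
    sub_eq_mul_integral_deriv (f := fun r => A r θ) (f' := fun r => A₁ r θ) (fun r => hA₁ r θ)
      (cA₁.comp (Continuous.prodMk_left θ)) r h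
  have hqB : ∀ h θ, B (r + h) θ - B r θ = h * qB h θ := fun h θ =>
    sub_eq_mul_integral_deriv (f := fun r => B r θ) (f' := fun r => B₁ r θ) (fun r => hB₁ r θ)
      (cB₁.comp (Continuous.prodMk_left θ)) r h
  have cq : ∀ G : ℝ → ℝ → ℝ, Continuous G.uncurry →
      Continuous (fun p : ℝ × ℝ => ∫ s in (0 : ℝ)..1, G (r + s * p.1) p.2) := fun G hG =>
    intervalIntegral.continuous_parametric_intervalIntegral_of_continuous'
      (f := fun (p : ℝ × ℝ) s => G (r + s * p.1) p.2)
      (hG.comp (by fun_prop : Continuous fun q : (ℝ × ℝ) × ℝ => (r + q.2 * q.1.1, q.1.2))) 0 1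
  have cqA : Continuous qA.uncurry := cq A₁ cA₁
  have cqB : Continuous qB.uncurry := cq B₁ cB₁
  have hΦ : Continuous fun h => ∫ θ in c..d, (qA h θ * B₂ (r + h) θ - A₂ r θ * qB h θ) :=
    intervalIntegral.continuous_parametric_intervalIntegral_of_continuous'
      (f := fun h θ => qA h θ * B₂ (r + h) θ - A₂ r θ * qB h θ)
      ((cqA.mul (cB₂.comp (by fun_prop : Continuous fun q : ℝ × ℝ => (r + q.1, q.2)))).sub
        ((cA₂.comp (by fun_prop : Continuous fun q : ℝ × ℝ => (r, q.2))).mul cqB)) c d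
  -- Integration by parts moves the `θ`-derivative off the increment of `B`; a mixed second
  -- derivative need not exist for `C¹` families. Boundary terms cancel because the curves are
  -- closed.
  have hparts : ∀ h, (∫ θ in c..d, A r θ * (B₂ (r + h) θ - B₂ r θ)) =
      -∫ θ in c..d, A₂ r θ * (B (r + h) θ - B r θ) := fun h => by
    rw [intervalIntegral.integral_mul_deriv_eq_deriv_mul (fun θ _ => hA₂ r θ)
      (fun θ _ => (hB₂ (r + h) θ).sub (hB₂ r θ)) ((cA₂' r).intervalIntegrable _ _)
      (((cB₂' _).sub (cB₂' _)).intervalIntegrable _ _)]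
    simp only [Pi.sub_apply, hA, hB, sub_self, zero_sub]
  have hslope : ∀ h, (∫ θ in c..d, A (r + h) θ * B₂ (r + h) θ) - (∫ θ in c..d, A r θ * B₂ r θ) =
      h * ∫ θ in c..d, (qA h θ * B₂ (r + h) θ - A₂ r θ * qB h θ) := fun h => by
    have im : ∀ {f g : ℝ → ℝ}, Continuous f → Continuous g →
        IntervalIntegrable (fun θ => f θ * g θ) volume c d := fun hf hg =>
      (hf.mul hg).intervalIntegrable _ _
    have is : ∀ {f g : ℝ → ℝ}, Continuous f → Continuous g → Continuous fun θ => f θ - g θ :=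
      fun hf hg => hf.sub hg
    rw [← intervalIntegral.integral_const_mul, ← intervalIntegral.integral_sub
      (im (cA _) (cB₂' _)) (im (cA _) (cB₂' _))]
    have e1 : ∀ θ, A (r + h) θ * B₂ (r + h) θ - A r θ * B₂ r θ =
        (A (r + h) θ - A r θ) * B₂ (r + h) θ + A r θ * (B₂ (r + h) θ - B₂ r θ) := fun θ => by ring
    have e2 : ∀ θ, h * (qA h θ * B₂ (r + h) θ - A₂ r θ * qB h θ) =
        (A (r + h) θ - A r θ) * B₂ (r + h) θ - A₂ r θ * (B (r + h) θ - B r θ) := fun θ => by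
      rw [hqA, hqB]; ring
    simp only [e1, e2]
    rw [intervalIntegral.integral_add (im (is (cA _) (cA _)) (cB₂' _))
      (im (cA _) (is (cB₂' _) (cB₂' _))), hparts, intervalIntegral.integral_sub
      (im (is (cA _) (cA _)) (cB₂' _)) (im (cA₂' _) (is (cB _) (cB _))), sub_eq_add_neg]
  rw [hasDerivAt_iff_tendsto_slope_zero]
  have hlim := (hΦ.tendsto 0).mono_left (nhdsWithin_le_nhds (s := {0}ᶜ))
  have h0 : (fun θ => qA 0 θ * B₂ (r + 0) θ - A₂ r θ * qB 0 θ) =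
      fun θ => A₁ r θ * B₂ r θ - A₂ r θ * B₁ r θ := by
    funext θ
    simp [qA, qB]
  rw [h0] at hlim
  refine hlim.congr' ?_
  filter_upwards [self_mem_nhdsWithin] with h hh
  rw [hslope, smul_eq_mul, inv_mul_cancel_left₀ hh]

end SweptArea

/-- Green's formula for the area swept out by a `C¹` map of the unit disc. -/
theorem setIntegral_ball_jacobian {Y : ℂ → ℂ} (hY : ContDiff ℝ 1 Y) :
    ∫ ξ in Metric.ball (0 : ℂ) 1, ((fderiv ℝ Y ξ 1).re * (fderiv ℝ Y ξ Complex.I).im -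
        (fderiv ℝ Y ξ 1).im * (fderiv ℝ Y ξ Complex.I).re) =
      ∫ θ in (-Real.pi)..Real.pi, (Y (Complex.exp (θ * Complex.I))).re *
        (fderiv ℝ Y (Complex.exp (θ * Complex.I))
          (Complex.exp (θ * Complex.I) * Complex.I)).im := by
  let e : ℝ → ℂ := fun θ => Complex.exp (θ * Complex.I)
  have he : ∀ θ, HasDerivAt e (e θ * Complex.I) θ := fun θ => by
    have h1 : HasDerivAt (fun θ : ℝ => (θ : ℂ) * Complex.I) Complex.I θ := by
      simpa using (Complex.ofRealCLM.hasDerivAt (x := θ)).mul_const Complex.I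
    exact h1.cexp
  have hec : Continuous e := continuous_iff_continuousAt.2 fun θ => (he θ).continuousAt
  have hYd : ∀ ξ, HasFDerivAt Y (fderiv ℝ Y ξ) ξ := fun ξ =>
    (hY.differentiable one_ne_zero ξ).hasFDerivAt
  have hYc : Continuous fun q : ℂ × ℂ => fderiv ℝ Y q.1 q.2 := hY.continuous_fderiv_apply one_ne_zero
  let J : ℂ → ℝ := fun ξ => (fderiv ℝ Y ξ 1).re * (fderiv ℝ Y ξ Complex.I).im -
        (fderiv ℝ Y ξ 1).im * (fderiv ℝ Y ξ Complex.I).re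
  have hJc : Continuous J := by
    have h1 : Continuous fun ξ => fderiv ℝ Y ξ 1 := hYc.comp (Continuous.prodMk_left 1)
    have h2 : Continuous fun ξ => fderiv ℝ Y ξ Complex.I := hYc.comp (Continuous.prodMk_left _)
    exact ((Complex.continuous_re.comp h1).mul (Complex.continuous_im.comp h2)).sub
      ((Complex.continuous_im.comp h1).mul (Complex.continuous_re.comp h2))
  have hr : ∀ r θ : ℝ, HasDerivAt (fun r : ℝ => Y (r * e θ)) (fderiv ℝ Y (r * e θ) (e θ)) r :=
    fun r θ => (hYd _).comp_hasDerivAt r (by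
      simpa using (Complex.ofRealCLM.hasDerivAt (x := r)).mul_const (e θ))
  have hθ : ∀ r θ : ℝ, HasDerivAt (fun θ : ℝ => Y (r * e θ))
      (fderiv ℝ Y (r * e θ) (r * (e θ * Complex.I))) θ :=
    fun r θ => (hYd _).comp_hasDerivAt θ ((he θ).const_mul (r : ℂ))
  have cr : Continuous fun q : ℝ × ℝ => fderiv ℝ Y (q.1 * e q.2) (e q.2) :=
    hYc.comp (by fun_prop : Continuous fun q : ℝ × ℝ => ((q.1 : ℂ) * e q.2, e q.2))
  have cθ : Continuous fun q : ℝ × ℝ => fderiv ℝ Y (q.1 * e q.2) (q.1 * (e q.2 * Complex.I)) :=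
    hYc.comp (by fun_prop : Continuous fun q : ℝ × ℝ =>
      ((q.1 : ℂ) * e q.2, (q.1 : ℂ) * (e q.2 * Complex.I)))
  have hre : ∀ {f : ℝ → ℂ} {f' : ℂ} {x : ℝ}, HasDerivAt f f' x →
      HasDerivAt (fun x => (f x).re) f'.re x := fun h =>
    Complex.reCLM.hasFDerivAt.comp_hasDerivAt _ h
  have him : ∀ {f : ℝ → ℂ} {f' : ℂ} {x : ℝ}, HasDerivAt f f' x →
      HasDerivAt (fun x => (f x).im) f'.im x := fun h =>
    Complex.imCLM.hasFDerivAt.comp_hasDerivAt _ h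
  have hper : e (-Real.pi) = e Real.pi := by
    simp only [e]
    push_cast
    rw [neg_mul, Complex.exp_neg, Complex.exp_pi_mul_I]
    norm_num
  -- The area enclosed by the image of the circle of radius `r` has derivative `∫ r J`, and it is
  -- zero at `r = 0`. Integrating in `r` gives the Jacobian integral in polar coordinates.
  have hswept := hasDerivAt_integral_mul_deriv (c := -Real.pi) (d := Real.pi)
    (A := fun r θ => (Y (r * e θ)).re) (B := fun r θ => (Y (r * e θ)).im)
    (fun r θ => hre (hr r θ)) (fun r θ => hre (hθ r θ))
    (fun r θ => him (hr r θ)) (fun r θ => him (hθ r θ))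
    (Complex.continuous_re.comp cr) (Complex.continuous_re.comp cθ)
    (Complex.continuous_im.comp cr) (Complex.continuous_im.comp cθ)
    (fun r => by simp only [hper]) (fun r => by simp only [hper])
  have hjac : ∀ r θ : ℝ, (fderiv ℝ Y (r * e θ) (e θ)).re *
      (fderiv ℝ Y (r * e θ) (r * (e θ * Complex.I))).im -
      (fderiv ℝ Y (r * e θ) (r * (e θ * Complex.I))).re * (fderiv ℝ Y (r * e θ) (e θ)).im =
      r * J (r * e θ) := by
    intro r θ
    have h1 : e θ = Real.cos θ • (1 : ℂ) + Real.sin θ • Complex.I := by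
      simp only [e, Complex.exp_mul_I]
      simp
    have h2 : (r : ℂ) * (e θ * Complex.I) =
        (-(r * Real.sin θ)) • (1 : ℂ) + (r * Real.cos θ) • Complex.I := by
      rw [h1]
      apply Complex.ext <;> simp
    have h3 := Real.sin_sq_add_cos_sq θ
    rw [h2]
    generalize (r : ℂ) * e θ = z
    rw [h1]
    simp only [map_add, map_smul, Complex.add_re, Complex.add_im, Complex.smul_re, Complex.smul_im,
      smul_eq_mul, J]
    linear_combination (r * ((fderiv ℝ Y z 1).re * (fderiv ℝ Y z Complex.I).im -
        (fderiv ℝ Y z 1).im * (fderiv ℝ Y z Complex.I).re)) * h3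
  simp only [hjac] at hswept
  have hF : Continuous fun q : ℝ × ℝ => q.1 * J (q.1 * e q.2) :=
    continuous_fst.mul (hJc.comp (by fun_prop))
  have hFr : Continuous fun r : ℝ => ∫ θ in (-Real.pi)..Real.pi, r * J (r * e θ) :=
    intervalIntegral.continuous_parametric_intervalIntegral_of_continuous'
      (f := fun r θ : ℝ => r * J ((r : ℂ) * e θ)) hF _ _
  have hftc := intervalIntegral.integral_eq_sub_of_hasDerivAt (a := 0) (b := 1)
    (fun r _ => hswept r) (hFr.intervalIntegrable _ _)
  have hpolar : ∫ ξ in Metric.ball (0 : ℂ) 1, J ξ =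
      ∫ r in (0 : ℝ)..1, ∫ θ in (-Real.pi)..Real.pi, r * J (r * e θ) := by
    have hpi : -Real.pi ≤ Real.pi := by linarith [Real.pi_pos]
    rw [← integral_indicator Metric.isOpen_ball.measurableSet, ← Complex.integral_comp_polarCoord_symm,
      polarCoord_target]
    have hset : ∀ p ∈ Set.Ioi (0 : ℝ) ×ˢ Set.Ioo (-Real.pi) Real.pi,
        p.1 • (Metric.ball (0 : ℂ) 1).indicator J (Complex.polarCoord.symm p) =
          (Set.Ioo (0 : ℝ) 1 ×ˢ Set.Ioo (-Real.pi) Real.pi).indicator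
            (fun q : ℝ × ℝ => q.1 * J (q.1 * e q.2)) p := by
      rintro ⟨r, θ⟩ ⟨hr0, hθ0⟩
      have hr0' : (0 : ℝ) < r := hr0
      have h1 : Complex.polarCoord.symm (r, θ) = r * e θ := by
        rw [Complex.polarCoord_symm_apply]
        simp [e, Complex.exp_mul_I]
      have h2 : ‖(r : ℂ) * e θ‖ = r := by
        rw [norm_mul, Complex.norm_real, Complex.norm_exp_ofReal_mul_I, mul_one,
          Real.norm_of_nonneg hr0'.le]
      rw [h1]
      by_cases hlt : r < 1
      · rw [Set.indicator_of_mem (mem_ball_zero_iff.2 (h2.trans_lt hlt)),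
          Set.indicator_of_mem 
            (show (r, θ) ∈ Set.Ioo (0 : ℝ) 1 ×ˢ Set.Ioo (-Real.pi) Real.pi from ⟨⟨hr0', hlt⟩, hθ0⟩), smul_eq_mul]
      · rw [Set.indicator_of_notMem fun h => hlt (h2 ▸ mem_ball_zero_iff.1 h),
          Set.indicator_of_notMem fun h => hlt h.1.2, smul_zero]
    rw [setIntegral_congr_fun (measurableSet_Ioi.prod measurableSet_Ioo) hset,
      setIntegral_indicator (measurableSet_Ioo.prod measurableSet_Ioo)]
    have hinter : Set.Ioi (0 : ℝ) ×ˢ Set.Ioo (-Real.pi) Real.pi ∩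
        Set.Ioo (0 : ℝ) 1 ×ˢ Set.Ioo (-Real.pi) Real.pi =
        Set.Ioo (0 : ℝ) 1 ×ˢ Set.Ioo (-Real.pi) Real.pi :=
      Set.inter_eq_right.2 (Set.prod_mono (fun x hx => hx.1) le_rfl)
    rw [hinter, Measure.volume_eq_prod, setIntegral_prod]
    · rw [intervalIntegral.integral_of_le zero_le_one, integral_Ioc_eq_integral_Ioo]
      refine setIntegral_congr_fun measurableSet_Ioo fun r _ => ?_
      rw [intervalIntegral.integral_of_le hpi, integral_Ioc_eq_integral_Ioo]
    · have hc := hF.continuousOn.integrableOn_compact (μ := (volume : Measure ℝ).prod volume)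
        ((isCompact_Icc (a := (0 : ℝ)) (b := 1)).prod (isCompact_Icc (a := -Real.pi) (b := Real.pi)))
      exact hc.mono_set (Set.prod_mono Set.Ioo_subset_Icc_self Set.Ioo_subset_Icc_self)
  rw [show (∫ ξ in Metric.ball (0 : ℂ) 1, ((fderiv ℝ Y ξ 1).re * (fderiv ℝ Y ξ Complex.I).im -
        (fderiv ℝ Y ξ 1).im * (fderiv ℝ Y ξ Complex.I).re)) = ∫ ξ in Metric.ball (0 : ℂ) 1, J ξ from rfl,
    hpolar, hftc]
  simp [e]

/-! ### Projections of a projective hedgehog to planes -/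

theorem sphereDir_apply_two_pos_iff (ξ : ℂ) : 0 < sphereDir ξ 2 ↔ ξ ∈ Metric.ball (0 : ℂ) 1 := by
  have h1 := one_add_sq_add_sq_pos ξ.re ξ.im
  rw [sphereDir_apply_two, div_pos_iff_of_pos_right h1, ← Complex.norm_sq_eq_re_im,
    mem_ball_zero_iff, sub_pos, sq_lt_one_iff₀ (norm_nonneg ξ)]

theorem sphereDir_of_norm_eq_one {ξ : ℂ} (hξ : ‖ξ‖ = 1) : sphereDir ξ = pointOf ξ 0 := by
  have h1 : ξ.re ^ 2 + ξ.im ^ 2 = 1 := by rw [← Complex.norm_sq_eq_re_im, hξ, one_pow]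
  apply E3.ext_three
  · rw [sphereDir_apply_zero, h1, pointOf_apply_zero]; ring
  · rw [sphereDir_apply_one, h1, pointOf_apply_one]; ring
  · rw [sphereDir_apply_two, h1, pointOf_apply_two]; ring

namespace IsProjectiveHedgehog

variable {X : E3 → E3}

theorem jacobian_planeCoord (hX : IsProjectiveHedgehog X) (ξ η : ℂ) :
    fderiv ℝ (fun ζ => planeCoord (X (sphereDir ζ))) ξ η =
      planeCoord (lineFoot ξ (coordDeriv X ξ η)) := by
  rw [hX.lineFoot_coordDeriv]
  have h := planeCoord.hasFDerivAt.comp ξ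
    (hX.contDiff_comp_sphereDir.differentiable one_ne_zero ξ).hasFDerivAt
  exact DFunLike.congr_fun h.fderiv η

/-- The projection of a projective hedgehog to a plane has nonpositive area. -/
theorem integral_radiiProd_mul_height (hX : IsProjectiveHedgehog X) :
    (∫ ξ, radiiProd X (sphereDir ξ) * max (sphereDir ξ 2) 0 * (4 / (1 + ‖ξ‖ ^ 2) ^ 2)) ≤ 0 ∧
      ((∫ ξ, radiiProd X (sphereDir ξ) * max (sphereDir ξ 2) 0 * (4 / (1 + ‖ξ‖ ^ 2) ^ 2)) = 0 →
        ∀ ξ ζ : ℂ, ‖ξ‖ = 1 → ‖ζ‖ = 1 →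
          planeCoord (X (sphereDir ξ)) = planeCoord (X (sphereDir ζ))) := by
  set Y : ℂ → ℂ := fun ζ => planeCoord (X (sphereDir ζ)) with hYdef
  have hY : ContDiff ℝ 1 Y := planeCoord.contDiff.comp hX.contDiff_comp_sphereDir
  -- By `lineFoot_minor`, projecting the tangent plane to the horizontal plane multiplies area by
  -- the height `sphereDir ξ 2`; the upper hemisphere is the unit disc.
  have hJ : (∫ ξ, radiiProd X (sphereDir ξ) * max (sphereDir ξ 2) 0 * (4 / (1 + ‖ξ‖ ^ 2) ^ 2)) =
      ∫ ξ in Metric.ball (0 : ℂ) 1, ((fderiv ℝ Y ξ 1).re * (fderiv ℝ Y ξ Complex.I).im -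
        (fderiv ℝ Y ξ 1).im * (fderiv ℝ Y ξ Complex.I).re) := by
    rw [← integral_indicator Metric.isOpen_ball.measurableSet]
    congr 1
    funext ξ
    by_cases hξ : ξ ∈ Metric.ball (0 : ℂ) 1
    · rw [Set.indicator_of_mem hξ, hX.jacobian_planeCoord, hX.jacobian_planeCoord,
        max_eq_left ((sphereDir_apply_two_pos_iff ξ).2 hξ).le, hX.radiiProd_sphereDir]
      simp only [planeCoord_re, planeCoord_im]
      rw [lineFoot_minor]
      ring
    · rw [Set.indicator_of_notMem hξ,
        max_eq_right (not_lt.1 fun h => hξ ((sphereDir_apply_two_pos_iff ξ).1 h))]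
      ring
  let e : ℝ → ℂ := fun θ => Complex.exp (θ * Complex.I)
  have he : ∀ θ, HasDerivAt e (e θ * Complex.I) θ := fun θ => by
    have h1 : HasDerivAt (fun θ : ℝ => (θ : ℂ) * Complex.I) Complex.I θ := by
      simpa using (Complex.ofRealCLM.hasDerivAt (x := θ)).mul_const Complex.I
    exact h1.cexp
  have hec : Continuous e := continuous_iff_continuousAt.2 fun θ => (he θ).continuousAt
  have hen : ∀ θ, ‖e θ‖ = 1 := fun θ => Complex.norm_exp_ofReal_mul_I θ
  have here : ∀ θ, (e θ).re = Real.cos θ := fun θ => Complex.exp_ofReal_mul_I_re θ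
  have heim : ∀ θ, (e θ).im = Real.sin θ := fun θ => Complex.exp_ofReal_mul_I_im θ
  have hYe : ∀ θ, HasDerivAt (fun θ => Y (e θ)) (fderiv ℝ Y (e θ) (e θ * Complex.I)) θ := fun θ =>
    (hY.differentiable one_ne_zero _).hasFDerivAt.comp_hasDerivAt θ (he θ)
  -- On the unit circle `-ξ` is the antipode of `ξ`, so evenness of `X` makes the boundary curve run
  -- twice around the same loop.
  have hper : Function.Periodic (fun θ => Y (e θ)) Real.pi := fun θ => by
    have h1 : e (θ + Real.pi) = -e θ := by
      apply Complex.ext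
      · rw [Complex.neg_re, here, here, Real.cos_add_pi]
      · rw [Complex.neg_im, heim, heim, Real.sin_add_pi]
    have h2 : sphereDir (-e θ) = -sphereDir (e θ) := by
      rw [sphereDir_of_norm_eq_one (by rw [norm_neg, hen]), sphereDir_of_norm_eq_one (hen θ)]
      apply E3.ext_three <;> simp [pointOf]
    simp only [Y, h1, h2, hX.neg _ (sphereDir_ne_zero _)]
  have hcirc := integral_mul_deriv_le_of_hedgehog (a := fun θ => (Y (e θ)).re)
    (b := fun θ => (Y (e θ)).im) (fun θ => Complex.reCLM.hasFDerivAt.comp_hasDerivAt θ (hYe θ))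
    (fun θ => Complex.imCLM.hasFDerivAt.comp_hasDerivAt θ (hYe θ))
    (Complex.continuous_im.comp ((hY.continuous_fderiv_apply one_ne_zero).comp
      (by fun_prop : Continuous fun θ => (e θ, e θ * Complex.I))))
    (fun θ => congrArg Complex.re (hper θ)) (fun θ => congrArg Complex.im (hper θ)) (fun θ => by
      have h1 := inner_lineFoot_sphereDir (e θ) (coordDeriv X (e θ) (e θ * Complex.I))
      rw [E3.inner_eq, sphereDir_of_norm_eq_one (hen θ), pointOf_apply_zero, pointOf_apply_one,
        pointOf_apply_two, mul_zero, add_zero, here, heim] at h1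
      simp only [Complex.reCLM_apply, Complex.imCLM_apply, Y]
      rw [hX.jacobian_planeCoord, planeCoord_re, planeCoord_im]
      exact h1)
  rw [hJ, setIntegral_ball_jacobian hY]
  refine ⟨hcirc.1, fun hz ξ ζ hξ hζ => ?_⟩
  have harg : ∀ z : ℂ, ‖z‖ = 1 → e z.arg = z := fun z hz => by
    simpa [hz] using Complex.norm_mul_exp_arg_mul_I z
  have h := hcirc.2 hz ξ.arg ζ.arg
  simp only [harg ξ hξ, harg ζ hζ] at h
  exact Complex.ext h.1 h.2

theorem hasFDerivAt_conjIsometry (hX : IsProjectiveHedgehog X) (R : E3 ≃ₗᵢ[ℝ] E3) {u : E3} (hu : u ≠ 0) :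
    HasFDerivAt (fun u => R.symm (X (R u)))
      ((R.symm.toContinuousLinearEquiv : E3 →L[ℝ] E3).comp
        ((fderiv ℝ X (R u)).comp (R.toContinuousLinearEquiv : E3 →L[ℝ] E3))) u :=
  (R.symm.toContinuousLinearEquiv : E3 →L[ℝ] E3).hasFDerivAt.comp u
    ((hX.hasFDerivAt ((map_ne_zero_iff R R.injective).2 hu)).comp u
      (R.toContinuousLinearEquiv : E3 →L[ℝ] E3).hasFDerivAt)

theorem conjIsometry (hX : IsProjectiveHedgehog X) (R : E3 ≃ₗᵢ[ℝ] E3) :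
    IsProjectiveHedgehog fun u => R.symm (X (R u)) := by
  have hR : ∀ u, u ≠ 0 → R u ≠ 0 := fun u hu => (map_ne_zero_iff R R.injective).2 hu
  refine ⟨fun u hu => ?_, fun u hu t ht => ?_, fun u hu => ?_, fun u hu a => ?_⟩
  · exact R.symm.contDiff.contDiffAt.comp u
      (ContDiffAt.comp (f := fun u => R u) u (hX.contDiffAt _ (hR u hu)) R.contDiff.contDiffAt)
  · simp only [map_smul, hX.smul _ (hR u hu) t ht]
  · simp only [map_neg, hX.neg _ (hR u hu)]
  · rw [(hX.hasFDerivAt_conjIsometry R hu).fderiv]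
    have := hX.inner_fderiv _ (hR u hu) (R a)
    rw [← R.symm.inner_map_map, R.symm_apply_apply] at this
    exact this

theorem radiiProd_conjIsometry (hX : IsProjectiveHedgehog X) (R : E3 ≃ₗᵢ[ℝ] E3) {u : E3} (hu : u ≠ 0) :
    radiiProd (fun u => R.symm (X (R u))) u = radiiProd X (R u) := by
  have h : (hedgehogDeriv (fun u => R.symm (X (R u))) u : E3 →ₗ[ℝ] E3) =
      (R.symm.toLinearEquiv : E3 →ₗ[ℝ] E3) ∘ₗ (hedgehogDeriv X (R u) : E3 →ₗ[ℝ] E3) ∘ₗ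
        (R.symm.toLinearEquiv.symm : E3 →ₗ[ℝ] E3) := by
    ext1 a
    have h1 : ⟪R u, R a⟫_ℝ = ⟪u, a⟫_ℝ := R.inner_map_map u a
    show hedgehogDeriv _ u a = R.symm (hedgehogDeriv X (R u) (R a))
    simp only [hedgehogDeriv, (hX.hasFDerivAt_conjIsometry R hu).fderiv, add_apply,
      ContinuousLinearMap.smulRight_apply, innerSL_apply_apply, h1, map_add, map_smul,
      R.symm_apply_apply]
    rfl
  rw [radiiProd, radiiProd, h, LinearMap.det_conj]

end IsProjectiveHedgehog

/-- A reflection may reverse orientation. This is harmless, as `radiiProd` is a determinant and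
invariant under conjugation. -/
theorem exists_linearIsometryEquiv_apply_eq {v w : E3} (h : ‖v‖ = ‖w‖) :
    ∃ R : E3 ≃ₗᵢ[ℝ] E3, R v = w :=
  ⟨_, Submodule.reflection_sub h⟩

theorem setIntegral_ball_comp_linearIsometryEquiv (R : E3 ≃ₗᵢ[ℝ] E3) (f : E3 → ℝ) :
    ∫ x in Metric.ball (0 : E3) 1, f (R x) = ∫ x in Metric.ball (0 : E3) 1, f x := by
  have h := R.measurePreserving.setIntegral_preimage_emb
    R.toHomeomorph.toMeasurableEquiv.measurableEmbedding f (Metric.ball 0 1)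
  rwa [show R ⁻¹' Metric.ball (0 : E3) 1 = Metric.ball 0 1 by ext x; simp] at h

/-- The signed area of the projection of the hedgehog `X` along `v`, up to a constant factor. -/
noncomputable def projectionArea (X : E3 → E3) (v : E3) : ℝ :=
  ∫ x in Metric.ball (0 : E3) 1, radiiProd X (‖x‖⁻¹ • x) * max ⟪‖x‖⁻¹ • x, v⟫_ℝ 0

/-- An isometry carrying the vertical axis to `v` reduces this to the horizontal projection. In the
equality case `X u - X u'` is parallel to `v`, hence orthogonal to `u`. -/
theorem IsProjectiveHedgehog.projectionArea_le {X : E3 → E3} (hX : IsProjectiveHedgehog X) {v : E3}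
    (hv : ‖v‖ = 1) : projectionArea X v ≤ 0 ∧ (projectionArea X v = 0 →
      ∀ u u' : E3, ‖u‖ = 1 → ‖u'‖ = 1 → ⟪u, v⟫_ℝ = 0 → ⟪u', v⟫_ℝ = 0 → ⟪X u - X u', u⟫_ℝ = 0) := by
  obtain ⟨R, hR⟩ := exists_linearIsometryEquiv_apply_eq
    (v := (EuclideanSpace.single 2 1 : E3)) (w := v) (by simp [hv])
  obtain ⟨κ, hκ, hball⟩ := exists_setIntegral_ball_direction
  have hXR := hX.conjIsometry R
  have hheight : ∀ y : E3, ⟪R y, v⟫_ℝ = y 2 := fun y => by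
    rw [← hR, R.inner_map_map, E3.inner_eq]
    simp
  have h1 : projectionArea X v = κ * ∫ ξ, radiiProd (fun u => R.symm (X (R u))) (sphereDir ξ) *
      max (sphereDir ξ 2) 0 * (4 / (1 + ‖ξ‖ ^ 2) ^ 2) := by
    rw [projectionArea, ← setIntegral_ball_comp_linearIsometryEquiv R]
    refine Eq.trans ?_ (hball fun y => radiiProd (fun u => R.symm (X (R u))) y * max (y 2) 0)
    have hae : ∀ᵐ x : E3, x ≠ 0 := by
      simp [ae_iff]
    refine setIntegral_congr_ae Metric.isOpen_ball.measurableSet (hae.mono fun x hx _ => ?_)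
    have hx' : ‖x‖⁻¹ • x ≠ 0 := smul_ne_zero (inv_ne_zero (norm_ne_zero_iff.2 hx)) hx
    simp only [hX.radiiProd_conjIsometry R hx', R.norm_map, ← map_smul, hheight]
  obtain ⟨hle, heq⟩ := hXR.integral_radiiProd_mul_height
  rw [h1]
  refine ⟨mul_nonpos_of_nonneg_of_nonpos hκ.le hle, fun hz u u' hu hu' huv hu'v => ?_⟩
  have hz' := (mul_eq_zero.1 hz).resolve_left hκ.ne'
  have hdir : ∀ u : E3, ‖u‖ = 1 → ⟪u, v⟫_ℝ = 0 → ‖planeCoord (R.symm u)‖ = 1 ∧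
      sphereDir (planeCoord (R.symm u)) = R.symm u ∧ R.symm u 2 = 0 := fun u hu huv => by
    have h2 : R.symm u 2 = 0 := by rw [← hheight, R.apply_symm_apply, huv]
    have h3 : ‖planeCoord (R.symm u)‖ = 1 := by
      have h4 : ‖planeCoord (R.symm u)‖ ^ 2 = ‖R.symm u‖ ^ 2 := by
        rw [Complex.norm_sq_eq_re_im, planeCoord_re, planeCoord_im, ← real_inner_self_eq_norm_sq,
          E3.inner_eq, h2]
        ring
      rw [R.symm.norm_map, hu, one_pow] at h4
      exact (pow_eq_one_iff_of_nonneg (norm_nonneg _) two_ne_zero).1 h4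
    refine ⟨h3, ?_, h2⟩
    rw [sphereDir_of_norm_eq_one h3]
    exact E3.ext_three (planeCoord_re _) (planeCoord_im _) h2.symm
  obtain ⟨a1, a2, a3⟩ := hdir u hu huv
  obtain ⟨b1, b2, -⟩ := hdir u' hu' hu'v
  have h5 := heq hz' _ _ a1 b1
  rw [a2, b2, R.apply_symm_apply, R.apply_symm_apply] at h5
  rw [← R.symm.inner_map_map, map_sub, E3.inner_eq, a3]
  have h6 := congrArg Complex.re h5
  have h7 := congrArg Complex.im h5
  rw [planeCoord_re, planeCoord_re] at h6
  rw [planeCoord_im, planeCoord_im] at h7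
  simp [h6, h7]

/-! ### Averaging over all directions of projection -/

/-- The integral over the unit ball of the positive part of a linear functional of norm one. -/
theorem exists_setIntegral_max_inner : ∃ C : ℝ, 0 < C ∧ ∀ u : E3, ‖u‖ = 1 →
    ∫ v in Metric.ball (0 : E3) 1, max ⟪u, v⟫_ℝ 0 = C := by
  let e : E3 := EuclideanSpace.single 2 1
  have he : ‖e‖ = 1 := by simp [e]
  refine ⟨∫ v in Metric.ball (0 : E3) 1, max ⟪e, v⟫_ℝ 0, ?_, fun u hu => ?_⟩
  · have hc : Continuous fun v : E3 => max ⟪e, v⟫_ℝ 0 := by fun_prop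
    have hint : IntegrableOn (fun v : E3 => max ⟪e, v⟫_ℝ 0) (Metric.ball 0 1) :=
      (hc.continuousOn.integrableOn_compact (isCompact_closedBall 0 1)).mono_set
        Metric.ball_subset_closedBall
    have hnn : 0 ≤ᵐ[volume.restrict (Metric.ball (0 : E3) 1)] fun v : E3 => max ⟪e, v⟫_ℝ 0 :=
      Filter.Eventually.of_forall fun v => le_max_right _ _
    rw [setIntegral_pos_iff_support_of_nonneg_ae hnn hint]
    refine ((isOpen_lt continuous_const hc).inter Metric.isOpen_ball).measure_pos volume
      ⟨(1 / 2 : ℝ) • e, ?_, ?_⟩ |>.trans_le (measure_mono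
        (Set.inter_subset_inter_left _ fun v hv => (ne_of_gt hv : _)))
    · show 0 < max ⟪e, (1 / 2 : ℝ) • e⟫_ℝ 0
      rw [inner_smul_right, real_inner_self_eq_norm_sq, he]
      norm_num
    · rw [mem_ball_zero_iff, norm_smul, he]
      norm_num
  · obtain ⟨R, hR⟩ := exists_linearIsometryEquiv_apply_eq (v := e) (w := u) (by rw [he, hu])
    rw [← setIntegral_ball_comp_linearIsometryEquiv R]
    simp only [← hR, R.inner_map_map]

theorem exists_unit_orthogonal (u u' : E3) : ∃ v : E3, ‖v‖ = 1 ∧ ⟪u, v⟫_ℝ = 0 ∧ ⟪u', v⟫_ℝ = 0 := by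
  classical
  set K : Submodule ℝ E3 := Submodule.span ℝ (({u, u'} : Finset E3) : Set E3) with hK
  have h1 : Module.finrank ℝ K ≤ 2 :=
    (finrank_span_finset_le_card _).trans Finset.card_le_two
  have h2 := K.finrank_add_finrank_orthogonal
  rw [finrank_euclideanSpace_fin] at h2
  obtain ⟨v, hv, hv0⟩ := Submodule.exists_mem_ne_zero_of_ne_bot (p := Kᗮ) fun h => by
    rw [h, finrank_bot] at h2; omega
  have hn : ‖v‖ ≠ 0 := norm_ne_zero_iff.2 hv0
  have h3 : ∀ x ∈ K, ⟪x, ‖v‖⁻¹ • v⟫_ℝ = 0 := fun x hx => by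
    rw [inner_smul_right, (Submodule.mem_orthogonal K v).1 hv x hx, mul_zero]
  exact ⟨‖v‖⁻¹ • v, by rw [norm_smul, norm_inv, norm_norm, inv_mul_cancel₀ hn],
    h3 u (Submodule.subset_span (by simp)), h3 u' (Submodule.subset_span (by simp))⟩

theorem projectionArea_smul (X : E3 → E3) {t : ℝ} (ht : 0 ≤ t) (v : E3) :
    projectionArea X (t • v) = t * projectionArea X v := by
  rw [projectionArea, projectionArea, ← integral_const_mul]
  congr 1
  funext x
  rw [inner_smul_right]
  conv_lhs => rw [← mul_zero t, ← mul_max_of_nonneg _ _ ht]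
  ring

namespace IsProjectiveHedgehog

variable {X : E3 → E3}

theorem continuousAt_radiiProd (hX : IsProjectiveHedgehog X) {u : E3} (hu : u ≠ 0) :
    ContinuousAt (radiiProd X) u := by
  have h1 : ContinuousAt (fderiv ℝ X) u :=
    ((hX.contDiffAt u hu).fderiv_right (m := 0) (by norm_num)).continuousAt
  have h2 : Continuous fun u : E3 => (innerSL ℝ u).smulRight u := by fun_prop
  have h3 : ContinuousAt (hedgehogDeriv X) u := h1.add h2.continuousAt
  exact ContinuousLinearMap.continuous_det.continuousAt.comp h3

theorem continuousOn_radiiProd_direction (hX : IsProjectiveHedgehog X) :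
    ContinuousOn (fun x : E3 => radiiProd X (‖x‖⁻¹ • x)) {0}ᶜ := fun _ hx =>
  (ContinuousAt.comp (f := fun x : E3 => ‖x‖⁻¹ • x) (hX.continuousAt_radiiProd
    (smul_ne_zero (inv_ne_zero (norm_ne_zero_iff.2 hx)) hx))
    (contDiffAt_normalize (n := 0) hx).continuousAt).continuousWithinAt

theorem exists_bound_radiiProd (hX : IsProjectiveHedgehog X) :
    ∃ K : ℝ, 0 ≤ K ∧ ∀ x : E3, |radiiProd X (‖x‖⁻¹ • x)| ≤ K := by
  obtain ⟨K, hK⟩ := (isCompact_sphere (0 : E3) 1).exists_bound_of_continuousOn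
    (f := radiiProd X) fun u hu => (hX.continuousAt_radiiProd (by
      rintro rfl; simp at hu)).continuousWithinAt
  -- At `x = 0` the direction `‖x‖⁻¹ • x` is `0`, off the sphere, and its value needs a separate
  -- bound.
  refine ⟨max K |radiiProd X 0|, le_max_of_le_right (abs_nonneg _), fun x => ?_⟩
  rcases eq_or_ne x 0 with rfl | hx
  · simp
  · refine (hK _ ?_).trans (le_max_left _ _)
    rw [mem_sphere_zero_iff_norm, norm_smul, norm_inv, norm_norm,
      inv_mul_cancel₀ (norm_ne_zero_iff.2 hx)]

/-- The total curvature integral of a projective hedgehog is nonpositive, and vanishes only if the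
hedgehog is a point. -/
theorem setIntegral_radiiProd_le (hX : IsProjectiveHedgehog X) :
    (∫ x in Metric.ball (0 : E3) 1, radiiProd X (‖x‖⁻¹ • x)) ≤ 0 ∧
      ((∫ x in Metric.ball (0 : E3) 1, radiiProd X (‖x‖⁻¹ • x)) = 0 →
        ∀ u u', u ≠ 0 → u' ≠ 0 → X u = X u') := by
  obtain ⟨C, hC, hCu⟩ := exists_setIntegral_max_inner
  obtain ⟨K, hK0, hK⟩ := hX.exists_bound_radiiProd
  set q : E3 → ℝ := fun x => radiiProd X (‖x‖⁻¹ • x) with hq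
  have hqm : Measurable q := measurable_of_continuousOn_compl_singleton 0
    hX.continuousOn_radiiProd_direction
  have hdm : Measurable fun x : E3 => ‖x‖⁻¹ • x := by fun_prop
  let μ : Measure E3 := volume.restrict (Metric.ball 0 1)
  have : IsFiniteMeasure μ := ⟨by
    rw [Measure.restrict_apply_univ]; exact Metric.isBounded_ball.measure_lt_top⟩
  have hnorm : ∀ x : E3, ‖‖x‖⁻¹ • x‖ ≤ 1 := fun x => by
    rw [norm_smul, norm_inv, norm_norm]
    exact inv_mul_le_one
  have hbound : ∀ x v : E3, ‖v‖ ≤ 1 → ‖q x * max ⟪‖x‖⁻¹ • x, v⟫_ℝ 0‖ ≤ K := fun x v hv => by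
    rw [norm_mul, Real.norm_eq_abs, Real.norm_of_nonneg (le_max_right _ _)]
    refine (mul_le_mul (hK x) (max_le ?_ zero_le_one) (le_max_right _ _) hK0).trans_eq (mul_one K)
    refine (real_inner_le_norm _ _).trans ?_
    exact mul_le_one₀ (hnorm x) (norm_nonneg _) hv
  have hjoint : Measurable fun p : E3 × E3 => q p.2 * max ⟪‖p.2‖⁻¹ • p.2, p.1⟫_ℝ 0 :=
    (hqm.comp measurable_snd).mul
      (((hdm.comp measurable_snd).inner measurable_fst).max measurable_const)
  have hint : Integrable (fun p : E3 × E3 => q p.2 * max ⟪‖p.2‖⁻¹ • p.2, p.1⟫_ℝ 0) (μ.prod μ) := by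
    refine Integrable.of_bound hjoint.aestronglyMeasurable K ?_
    rw [Measure.prod_restrict]
    exact ae_restrict_of_forall_mem
      (Metric.isOpen_ball.measurableSet.prod Metric.isOpen_ball.measurableSet)
      fun p hp => hbound _ _ (mem_ball_zero_iff.1 hp.1).le
  have hne : ∀ᵐ x ∂μ, x ≠ 0 := ae_restrict_of_ae (by simp [ae_iff])
  -- Fubini: for fixed `x ≠ 0` the average of `max ⟪‖x‖⁻¹ • x, v⟫ 0` over `v` does not depend on
  -- `x`.
  have hfub : ∫ v, projectionArea X v ∂μ = C * ∫ x, q x ∂μ := by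
    have h1 := integral_integral_swap (f := fun v x => q x * max ⟪‖x‖⁻¹ • x, v⟫_ℝ 0) hint
    refine h1.trans ?_
    rw [← integral_const_mul]
    refine integral_congr_ae (hne.mono fun x hx => ?_)
    simp only [integral_const_mul]
    rw [hCu (‖x‖⁻¹ • x) (by rw [norm_smul, norm_inv, norm_norm,
      inv_mul_cancel₀ (norm_ne_zero_iff.2 hx)]), mul_comm]
  have hpa : ∀ v, projectionArea X v ≤ 0 := fun v => by
    rcases eq_or_ne v 0 with rfl | hv
    · simp [projectionArea]
    · have hn : 0 < ‖v‖ := norm_pos_iff.2 hv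
      have h1 : v = ‖v‖ • ‖v‖⁻¹ • v := by rw [smul_smul, mul_inv_cancel₀ hn.ne', one_smul]
      rw [h1, projectionArea_smul X hn.le]
      refine mul_nonpos_of_nonneg_of_nonpos hn.le (hX.projectionArea_le ?_).1
      rw [norm_smul, norm_inv, norm_norm, inv_mul_cancel₀ hn.ne']
  constructor
  · have h1 : C * ∫ x, q x ∂μ ≤ 0 := hfub ▸ integral_nonpos hpa
    exact nonpos_of_mul_nonpos_right h1 hC
  intro hz
  have hz' : ∫ x, q x ∂μ = 0 := hz
  rw [hz', mul_zero] at hfub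
  have hpaint : Integrable (projectionArea X) μ := hint.integral_prod_left
  have hae : (fun v => projectionArea X v) =ᵐ[μ] fun _ => (0 : ℝ) := by
    have h1 : ∫ v, -projectionArea X v ∂μ = 0 := by rw [integral_neg, hfub, neg_zero]
    have h2 := (integral_eq_zero_iff_of_nonneg (fun v => neg_nonneg.2 (hpa v)) hpaint.neg).1 h1
    filter_upwards [h2] with v hv
    exact neg_eq_zero.1 hv
  have hcont : ContinuousOn (projectionArea X) (Metric.ball 0 1) := by
    refine continuousOn_of_dominated (bound := fun _ => K)
      (fun v _ => (hqm.mul ((hdm.inner measurable_const).max measurable_const)).aestronglyMeasurable)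
      (fun v hv => Filter.Eventually.of_forall fun x => hbound x v (mem_ball_zero_iff.1 hv).le)
      (integrable_const K) (Filter.Eventually.of_forall fun x => ?_)
    exact Continuous.continuousOn (by fun_prop)
  have hzero := Measure.eqOn_open_of_ae_eq hae Metric.isOpen_ball hcont continuousOn_const
  -- Unit vectors lie outside the open ball of averaging; homogeneity transfers the value from `v /
  -- 2`.
  have hunit : ∀ v : E3, ‖v‖ = 1 → projectionArea X v = 0 := fun v hv => by
    have h1 : (1 / 2 : ℝ) • v ∈ Metric.ball (0 : E3) 1 := by
      rw [mem_ball_zero_iff, norm_smul, hv]; norm_num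
    have h2 := hzero h1
    simp only [projectionArea_smul X (by norm_num : (0 : ℝ) ≤ 1 / 2)] at h2
    linarith
  have hinner : ∀ u u' : E3, ‖u‖ = 1 → ‖u'‖ = 1 → ⟪X u - X u', u⟫_ℝ = 0 := fun u u' hu hu' => by
    obtain ⟨v, hv, h1, h2⟩ := exists_unit_orthogonal u u'
    exact (hX.projectionArea_le hv).2 (hunit v hv) u u' hu hu' h1 h2
  have hconst : ∀ u u' : E3, ‖u‖ = 1 → ‖u'‖ = 1 → X u = X u' := fun u u' hu hu' => by
    by_contra hne
    have hn : ‖X u - X u'‖ ≠ 0 := norm_ne_zero_iff.2 (sub_ne_zero.2 hne)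
    -- Testing with the unit vector `a` along `X u - X u'`: both `X a - X u` and `X a - X u'` are
    -- orthogonal to `a`, hence so is their difference, a multiple of `a`.
    set a := ‖X u - X u'‖⁻¹ • (X u - X u') with ha
    have ha1 : ‖a‖ = 1 := by rw [ha, norm_smul, norm_inv, norm_norm, inv_mul_cancel₀ hn]
    have h1 := hinner a u ha1 hu
    have h2 := hinner a u' ha1 hu'
    have h3 : ⟪X u - X u', a⟫_ℝ = 0 := by
      rw [← sub_sub_sub_cancel_left (X u') (X u) (X a), inner_sub_left, h1, h2, sub_zero]
    rw [ha, inner_smul_right, real_inner_self_eq_norm_sq] at h3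
    simp [hn] at h3
  intro u u' hu hu'
  have hn : ∀ u : E3, u ≠ 0 → ‖‖u‖⁻¹ • u‖ = 1 := fun u hu => by
    rw [norm_smul, norm_inv, norm_norm, inv_mul_cancel₀ (norm_ne_zero_iff.2 hu)]
  rw [← hX.smul u hu _ (inv_pos.2 (norm_pos_iff.2 hu)),
    ← hX.smul u' hu' _ (inv_pos.2 (norm_pos_iff.2 hu'))]
  exact hconst _ _ (hn u hu) (hn u' hu')

theorem integrable_radiiProd (hX : IsProjectiveHedgehog X) :
    Integrable fun ξ : ℂ => radiiProd X (sphereDir ξ) * (4 / (1 + ‖ξ‖ ^ 2) ^ 2) := by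
  obtain ⟨K, -, hK⟩ := hX.exists_bound_radiiProd
  have hdens : Integrable fun ξ : ℂ => 4 / (1 + ‖ξ‖ ^ 2) ^ 2 := by
    have h := (integrable_rpow_neg_one_add_norm_sq (E := ℂ) (μ := volume) (r := 4)
      (by rw [Complex.finrank_real_complex]; norm_num)).const_mul 4
    refine h.congr (Filter.Eventually.of_forall fun ξ => ?_)
    have hp : (0 : ℝ) ≤ 1 + ‖ξ‖ ^ 2 := by positivity
    show 4 * (1 + ‖ξ‖ ^ 2) ^ (-4 / 2 : ℝ) = 4 / (1 + ‖ξ‖ ^ 2) ^ 2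
    rw [show (-4 / 2 : ℝ) = -((2 : ℕ) : ℝ) by norm_num, Real.rpow_neg hp, Real.rpow_natCast,
      div_eq_mul_inv]
  have hc : Continuous fun ξ : ℂ => radiiProd X (sphereDir ξ) :=
    continuous_iff_continuousAt.2 fun ξ =>
      ContinuousAt.comp (f := sphereDir) (hX.continuousAt_radiiProd (sphereDir_ne_zero ξ))
        (contDiff_sphereDir (n := 0)).continuous.continuousAt
  refine hdens.bdd_mul hc.aestronglyMeasurable (c := K) (Filter.Eventually.of_forall fun ξ => ?_)
  have := hK (sphereDir ξ)
  rwa [norm_sphereDir, inv_one, one_smul] at this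

theorem integral_radiiProd_le (hX : IsProjectiveHedgehog X) :
    (∫ ξ : ℂ, radiiProd X (sphereDir ξ) * (4 / (1 + ‖ξ‖ ^ 2) ^ 2)) ≤ 0 ∧
      ((∫ ξ : ℂ, radiiProd X (sphereDir ξ) * (4 / (1 + ‖ξ‖ ^ 2) ^ 2)) = 0 →
        ∀ u u', u ≠ 0 → u' ≠ 0 → X u = X u') := by
  obtain ⟨κ, hκ, h⟩ := exists_setIntegral_ball_direction
  have h1 := hX.setIntegral_radiiProd_le
  rw [h (radiiProd X)] at h1
  exact ⟨nonpos_of_mul_nonpos_right h1.1 hκ, fun hz => h1.2 (by rw [hz, mul_zero])⟩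

end IsProjectiveHedgehog

/-! ### The case of equality and the main theorem -/

section ConstantWidth

variable {B : ConvexBody E3} {w : ℝ}

/-- A boundary point has a supporting plane, obtained by separating it from the nonempty interior.
Hence the support points exhaust the boundary. -/
theorem exists_eq_supportPoint_of_mem_frontier (hw : HasConstantWidth B w)
    (hint : (interior (B : Set E3)).Nonempty) {p : E3} (hp : p ∈ frontier (B : Set E3)) :
    ∃ u, u ≠ 0 ∧ p = supportPoint B u := by
  rw [B.isCompact.isClosed.frontier_eq] at hp
  obtain ⟨f, hf⟩ := geometric_hahn_banach_open_point B.convex.interior isOpen_interior hp.2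
  have hle : ∀ y ∈ B, f y ≤ f p := by
    have h1 : closure (interior (B : Set E3)) ⊆ {y | f y ≤ f p} :=
      closure_minimal (fun y hy => (hf y hy).le) (isClosed_le f.continuous continuous_const)
    intro y hy
    refine h1 ?_
    rw [B.convex.closure_interior_eq_closure_of_nonempty_interior hint]
    exact subset_closure hy
  have hfu : ∀ y, ⟪y, (InnerProductSpace.toDual ℝ E3).symm f⟫_ℝ = f y := fun y => by
    rw [real_inner_comm, InnerProductSpace.toDual_symm_apply]
  have hu : (InnerProductSpace.toDual ℝ E3).symm f ≠ 0 := fun h => by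
    obtain ⟨y, hy⟩ := hint
    have := hf y hy
    rw [← hfu, ← hfu, h, inner_zero_right, inner_zero_right] at this
    exact lt_irrefl _ this
  exact ⟨_, hu, hw.eq_supportPoint hu hp.1 fun y hy => by rw [hfu, hfu]; exact hle y hy⟩

theorem frontier_eq_sphere_of_centredSupportPoint_eq (hw : HasConstantWidth B w)
    (hint : (interior (B : Set E3)).Nonempty) {c : E3}
    (hc : ∀ u, u ≠ 0 → centredSupportPoint B w u = c) :
    frontier (B : Set E3) = Metric.sphere c (w / 2) := by
  have hx : ∀ u : E3, u ≠ 0 → supportPoint B u = c + (w / 2) • ‖u‖⁻¹ • u := fun u hu => by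
    rw [← hc u hu, centredSupportPoint, sub_add_cancel]
  have hfr : ∀ u : E3, u ≠ 0 → supportPoint B u ∈ frontier (B : Set E3) := fun u hu =>
    mem_frontier_of_isMax hu (supportPoint_mem B u) fun y hy => inner_le_inner_supportPoint hy u
  have hw0 := hw.nonneg
  ext y
  rw [mem_sphere_iff_norm]
  constructor
  · intro hy
    obtain ⟨u, hu, rfl⟩ := exists_eq_supportPoint_of_mem_frontier hw hint hy
    rw [hx u hu, add_sub_cancel_left, norm_smul, norm_smul, norm_inv, norm_norm,
      inv_mul_cancel₀ (norm_ne_zero_iff.2 hu), mul_one, Real.norm_of_nonneg (by linarith)]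
  · intro hy
    -- If `y = c` the radius is zero and `y - c` gives no direction; any direction then serves.
    rcases eq_or_ne y c with rfl | hne
    · rw [sub_self, norm_zero] at hy
      have he : (EuclideanSpace.single 0 1 : E3) ≠ 0 := by simp
      have := hfr _ he
      rwa [hx _ he, ← hy, zero_smul, add_zero] at this
    · have hu : y - c ≠ 0 := sub_ne_zero.2 hne
      have := hfr _ hu
      rwa [hx _ hu, ← hy, smul_smul, mul_inv_cancel₀ (norm_ne_zero_iff.2 hu), one_smul,
        add_sub_cancel] at this

/-- The point `c + (w/2) v` lies in `B`, so `⟪supportPoint B v - c, v⟫ ≥ w/2`. As `supportPoint B v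
- c` has length `w/2`, it must equal `(w/2) v`. -/
theorem centredSupportPoint_eq_of_frontier_eq_sphere (hw : HasConstantWidth B w) {c : E3}
    (hc : frontier (B : Set E3) = Metric.sphere c (w / 2)) {u : E3} (hu : u ≠ 0) :
    centredSupportPoint B w u = c := by
  have hw0 := hw.nonneg
  have hn : 0 < ‖u‖ := norm_pos_iff.2 hu
  set v : E3 := ‖u‖⁻¹ • u with hv
  have hv1 : ‖v‖ = 1 := by rw [hv, norm_smul, norm_inv, norm_norm, inv_mul_cancel₀ hn.ne']
  have hv0 : v ≠ 0 := by rw [← norm_ne_zero_iff, hv1]; exact one_ne_zero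
  have hp : supportPoint B u = supportPoint B v := (hw.supportPoint_smul hu (inv_pos.2 hn)).symm
  have h1 : c + (w / 2) • v ∈ B := by
    refine B.isCompact.isClosed.frontier_subset (?_ : c + (w / 2) • v ∈ frontier (B : Set E3))
    rw [hc, mem_sphere_iff_norm, add_sub_cancel_left, norm_smul, hv1, mul_one,
      Real.norm_of_nonneg (by linarith)]
  have h2 : supportPoint B v ∈ frontier (B : Set E3) :=
    mem_frontier_of_isMax hv0 (supportPoint_mem B v) fun y hy => inner_le_inner_supportPoint hy v
  rw [hc, mem_sphere_iff_norm] at h2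
  have h3 := inner_le_inner_supportPoint h1 v
  rw [inner_add_left, inner_smul_left, real_inner_self_eq_norm_sq, hv1] at h3
  simp only [conj_trivial, one_pow, mul_one] at h3
  have h4 : ‖supportPoint B v - c - (w / 2) • v‖ ^ 2 ≤ 0 := by
    rw [norm_sub_sq_real, h2, inner_smul_right, inner_sub_left, norm_smul, hv1, mul_one,
      Real.norm_of_nonneg (by linarith)]
    nlinarith
  have h5 := norm_eq_zero.1 (pow_eq_zero_iff two_ne_zero |>.1 (le_antisymm h4 (sq_nonneg _)))
  rw [centredSupportPoint, hp, ← hv]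
  rw [sub_right_comm] at h5
  exact sub_eq_zero.1 h5

end ConstantWidth

theorem radiiProd_sphereDir_eq_zero_of_const {X : E3 → E3} (hX : IsProjectiveHedgehog X) {c : E3}
    (hc : ∀ u, u ≠ 0 → X u = c) (ξ : ℂ) : radiiProd X (sphereDir ξ) = 0 := by
  have h1 : fderiv ℝ X (sphereDir ξ) = 0 := by
    have : X =ᶠ[𝓝 (sphereDir ξ)] fun _ => c := by
      filter_upwards [isOpen_ne.mem_nhds (sphereDir_ne_zero ξ)] with u hu
      exact hc u hu
    rw [this.fderiv_eq, fderiv_const_apply]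
  rw [hX.radiiProd_sphereDir]
  simp [coordDeriv, h1]

theorem theorem3 (B : ConvexBody E3) (w : ℝ) (hint : (interior (B : Set E3)).Nonempty)
    (hC2 : HasC2Boundary B) (hw : HasConstantWidth B w) :
    (∃! F : ℂ → ℂ, IsNormalCongruence B F) ∧
    ∀ F : ℂ → ℂ, IsNormalCongruence B F →
      ContDiff ℝ 1 F ∧
      (∀ ξ : ℂ, (slopePsi F ξ).im = 0) ∧
      Integrable (widthIntegrand B w F) ∧
      0 ≤ (∫ ξ : ℂ, widthIntegrand B w F ξ) ∧
      ((∫ ξ : ℂ, widthIntegrand B w F ξ) = 0 ↔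
        ∃ c : E3, frontier (B : Set E3) = Metric.sphere c (w / 2)) := by
  have hX := isProjectiveHedgehog_centredSupportPoint hC2 hw
  refine ⟨⟨_, (isNormalCongruence_iff hw).2 rfl, fun F hF => (isNormalCongruence_iff hw).1 hF⟩,
    fun F hF => ?_⟩
  obtain rfl := (isNormalCongruence_iff hw).1 hF
  have hI : widthIntegrand B w (fun ξ => lineCoord ξ (centredSupportPoint B w (sphereDir ξ))) =
      fun ξ => -(radiiProd (centredSupportPoint B w) (sphereDir ξ) * (4 / (1 + ‖ξ‖ ^ 2) ^ 2)) :=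
    funext fun ξ => widthIntegrand_eq hC2 hw ξ
  obtain ⟨hle, heq⟩ := hX.integral_radiiProd_le
  refine ⟨hX.contDiff_lineCoord, hX.slopePsi_im, ?_, ?_, ?_⟩
  · rw [hI]
    exact hX.integrable_radiiProd.neg
  · rw [hI, integral_neg]
    linarith
  · rw [hI, integral_neg, neg_eq_zero]
    constructor
    · intro hz
      refine ⟨centredSupportPoint B w (sphereDir 0),
        frontier_eq_sphere_of_centredSupportPoint_eq hw hint fun u hu => ?_⟩
      exact heq hz _ _ hu (sphereDir_ne_zero 0)
    · rintro ⟨c, hc⟩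
      have h1 := radiiProd_sphereDir_eq_zero_of_const hX fun u hu =>
        centredSupportPoint_eq_of_frontier_eq_sphere hw hc hu
      simp [h1]
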